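/- Let $Q\in\mathbb{R}^{m\times m}$ be symmetric and $D\in\mathbb{R}^{k\times m}$. For $(q,b)\in\mathbb{R}^m\times\mathbb{R}^k$ let $$\mathrm{qp}_{\rm opt}(q,b)=\inf\{\,q^Tz+\tfrac12 z^TQz \;:\; z\in\mathbb{R}^m,\ Dz\ge b\,\}\in[-\infty,+\infty],\qquad \mathrm{dom}(Q,D)=\{(q,b): -\infty<\mathrm{qp}_{\rm opt}(q,b)<+\infty\}.$$ A real function is *dc* on a convex set $S$ if on $S$ it is the difference of two convex functions on $S$ (so being dc on $S$ includes convexity of $S$). A *quadratic function* is a polynomial function of degree at most $2$. For $I\subseteq\{1,\dots,k\}$ fix a finite list of generators $(v^{I,\ell},\xi^{I,\ell})$, $1\le\ell\le L_I$, of the polyhedral cone $$\{(v,\xi)\in\mathbb{R}^m\times\mathbb{R}^k:\ Qv=D^T\xi,\ (Dv)_i=0\le\xi_i\ (i\in I),\ (Dv)_i\ge0=\xi_i\ (i\notin I)\},$$ let $\mathcal{E}(I,\ell)$ be the (finite) set of extreme points of $\{\mu\in\mathbb{R}^k_+: D^T\mu=Qv^{I,\ell}\}$, and for every selection $\boldsymbol\mu=(\mu^{I,\ell})$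 with $\mu^{I,\ell}\in\mathcal{E}(I,\ell)$ put $$\mathrm{dom}^{\boldsymbol\mu}=\{(q,b):\ \exists z,\ Dz\ge b;\ \ q^Tv^{I,\ell}+b^T\mu^{I,\ell}\ge0\ \text{ for all } I,\ell\}.$$ For $I'\subseteq\{1,\dots,k\}$ let $\mathrm{QD}(I')$ be the polyhedral cone of all $(q,b)$ for which there are $z,\eta$ with $q+Qz-D^T\eta=0$, $(Dz)_i=b_i,\ \eta_i\ge0$ for $i\in I'$, and $(Dz)_i\ge b_i,\ \eta_i=0$ for $i\notin I'$. Let $\mathcal{F}$ be the finite family of all the polyhedra $\mathrm{dom}^{\boldsymbol\mu}\cap\mathrm{QD}(I')$. 1. Suppose that $Q$ is copositive on $D_\infty=\{v: Dv\ge0\}$ (that is, $v^TQv\ge0$ for all $v\in D_\infty$) and that $\mathrm{dom}(Q,D)$ is convex. If on each member of $\mathcal{F}$ the function $\mathrm{qp}_{\rm opt}$ coincides with some quadratic function of $(q,b)$, then $\mathrm{qp}_{\rm opt}$ is dc, jointly in $(q,b)$, on $\mathrm{dom}(Q,D)$. This holds for every choice of the generators above. The same conclusion holds if $\mathcal{F}$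 is replaced by any finite family of polyhedra whose union contains $\mathrm{dom}(Q,D)$ and such that on the intersection of each member with $\mathrm{dom}(Q,D)$ the function $\mathrm{qp}_{\rm opt}$ coincides with some quadratic function. 2. In particular, if $Q$ is positive semidefinite, then $\mathrm{qp}_{\rm opt}$ is dc on $\mathrm{dom}(Q,D)$ (without further assumptions). 3. For every matrix $A\in\mathbb{R}^{r\times n}$, the linear programming value function $\varphi(b,c)=\inf\{c^Tz: Az=b,\ z\ge0\}$ is dc, jointly in $(b,c)$, on its domain of finiteness $\{(b,c):-\infty<\varphi(b,c)<+\infty\}$. -/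

import Mathlib

open scoped Matrix

noncomputable section

namespace QP

/-- A function `p` on a real vector space is quadratic: quadratic form + linear form + constant. -/
def IsQuadraticFunction {E : Type*} [AddCommGroup E] [Module ℝ E] (p : E → ℝ) : Prop :=
  ∃ (B : QuadraticForm ℝ E) (l : E →ₗ[ℝ] ℝ) (c : ℝ), ∀ x, p x = B x + l x + c

/-- `f` is dc (difference-of-convex) on `s`: there it is the difference of two functions that are
convex on `s`. Since `ConvexOn` includes convexity of `s`, so does this notion. -/
def IsDCOn {E : Type*} [AddCommGroup E] [Module ℝ E] (s : Set E) (f : E → ℝ) : Prop :=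
  ∃ g h : E → ℝ, ConvexOn ℝ s g ∧ ConvexOn ℝ s h ∧ ∀ x ∈ s, f x = g x - h x

/-- A polyhedron: the solution set of finitely many (weak) affine inequalities. -/
def IsPolyhedron {E : Type*} [AddCommGroup E] [Module ℝ E] (s : Set E) : Prop :=
  ∃ (n : ℕ) (a : Fin n → E →ₗ[ℝ] ℝ) (β : Fin n → ℝ), s = {x | ∀ i, a i x ≤ β i}

variable {m k : ℕ}

/-- The feasible set `{z | D z ≥ b}`. -/
def feasible (D : Matrix (Fin k) (Fin m) ℝ) (b : Fin k → ℝ) : Set (Fin m → ℝ) :=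
  {z | b ≤ D *ᵥ z}

/-- The recession cone `{v | D v ≥ 0}`. -/
def recCone (D : Matrix (Fin k) (Fin m) ℝ) : Set (Fin m → ℝ) :=
  {v | 0 ≤ D *ᵥ v}

/-- The matrix `Q` is copositive on the set `C`. -/
def CopositiveOn (Q : Matrix (Fin m) (Fin m) ℝ) (C : Set (Fin m → ℝ)) : Prop :=
  ∀ v ∈ C, 0 ≤ v ⬝ᵥ (Q *ᵥ v)

/-- The objective `qᵀ z + ½ zᵀ Q z`. -/
def objective (Q : Matrix (Fin m) (Fin m) ℝ) (q : Fin m → ℝ) (z : Fin m → ℝ) : ℝ :=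
  q ⬝ᵥ z + (1 / 2) * (z ⬝ᵥ (Q *ᵥ z))

/-- The extended-real optimal value of `min qᵀ z + ½ zᵀ Q z` subject to `D z ≥ b`; it is `⊤` for an
infeasible and `⊥` for an unbounded program. -/
def optVal (Q : Matrix (Fin m) (Fin m) ℝ) (D : Matrix (Fin k) (Fin m) ℝ)
    (x : (Fin m → ℝ) × (Fin k → ℝ)) : EReal :=
  ⨅ z ∈ feasible D x.2, (objective Q x.1 z : EReal)

/-- The domain of finiteness `dom(Q, D)`, as a set of pairs `(q, b)`. -/
def dom (Q : Matrix (Fin m) (Fin m) ℝ) (D : Matrix (Fin k) (Fin m) ℝ) :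
    Set ((Fin m → ℝ) × (Fin k → ℝ)) :=
  {x | ⊥ < optVal Q D x ∧ optVal Q D x < ⊤}

/-- The real-valued optimal value function; meaningful on `dom Q D`. -/
def qpOpt (Q : Matrix (Fin m) (Fin m) ℝ) (D : Matrix (Fin k) (Fin m) ℝ)
    (x : (Fin m → ℝ) × (Fin k → ℝ)) : ℝ :=
  (optVal Q D x).toReal

/-- The cone of all `(v, ξ)` with `Q v = Dᵀ ξ`, where `(D v)_i = 0 ≤ ξ_i` for `i ∈ I` and
`(D v)_i ≥ 0 = ξ_i` for `i ∉ I`: the recession cone of the KKT system with active set `I`. -/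
def kktRecCone (Q : Matrix (Fin m) (Fin m) ℝ) (D : Matrix (Fin k) (Fin m) ℝ)
    (I : Finset (Fin k)) : Set ((Fin m → ℝ) × (Fin k → ℝ)) :=
  {x | Q *ᵥ x.1 - Dᵀ *ᵥ x.2 = 0 ∧
    (∀ i ∈ I, (D *ᵥ x.1) i = 0 ∧ 0 ≤ x.2 i) ∧
    (∀ i, i ∉ I → 0 ≤ (D *ᵥ x.1) i ∧ x.2 i = 0)}

/-- `gen I` is, for every `I`, a finite list of generators of the polyhedral cone
`kktRecCone Q D I`: the cone consists exactly of the nonnegative combinations of the list. -/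
def IsGeneratorSystem (Q : Matrix (Fin m) (Fin m) ℝ) (D : Matrix (Fin k) (Fin m) ℝ)
    (L : Finset (Fin k) → ℕ)
    (gen : (I : Finset (Fin k)) → Fin (L I) → (Fin m → ℝ) × (Fin k → ℝ)) : Prop :=
  ∀ I, kktRecCone Q D I =
    {x | ∃ c : Fin (L I) → ℝ, (∀ l, 0 ≤ c l) ∧ x = ∑ l, c l • gen I l}

/-- The extreme points of the polyhedron `{μ ≥ 0 | Dᵀ μ = Q v}`. -/
def dualVertices (Q : Matrix (Fin m) (Fin m) ℝ) (D : Matrix (Fin k) (Fin m) ℝ)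
    (v : Fin m → ℝ) : Set (Fin k → ℝ) :=
  Set.extremePoints ℝ {μ : Fin k → ℝ | 0 ≤ μ ∧ Dᵀ *ᵥ μ = Q *ᵥ v}

/-- The polyhedron of all `(q, b)` such that `D z ≥ b` is feasible and
`qᵀ v + bᵀ μ ≥ 0` for every generator `(v, ξ) = gen I l` and the vector `μ = mu I l` paired
with it. -/
def domPiece (D : Matrix (Fin k) (Fin m) ℝ) (L : Finset (Fin k) → ℕ)
    (gen : (I : Finset (Fin k)) → Fin (L I) → (Fin m → ℝ) × (Fin k → ℝ))
    (mu : (I : Finset (Fin k)) → Fin (L I) → (Fin k → ℝ)) :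
    Set ((Fin m → ℝ) × (Fin k → ℝ)) :=
  {x | (feasible D x.2).Nonempty ∧ ∀ I l, 0 ≤ x.1 ⬝ᵥ (gen I l).1 + x.2 ⬝ᵥ mu I l}

/-- The polyhedral cone of all `(q, b)` for which the KKT system with active set `I` is solvable:
`q + Q z = Dᵀ η`, `(D z)_i = b_i` and `η_i ≥ 0` for `i ∈ I`, `(D z)_i ≥ b_i` and `η_i = 0`
for `i ∉ I`. -/
def kktCone (Q : Matrix (Fin m) (Fin m) ℝ) (D : Matrix (Fin k) (Fin m) ℝ)
    (I : Finset (Fin k)) : Set ((Fin m → ℝ) × (Fin k → ℝ)) :=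
  {x | ∃ (z : Fin m → ℝ) (η : Fin k → ℝ), x.1 + Q *ᵥ z - Dᵀ *ᵥ η = 0 ∧
    (∀ i ∈ I, (D *ᵥ z) i = x.2 i ∧ 0 ≤ η i) ∧
    (∀ i, i ∉ I → x.2 i ≤ (D *ᵥ z) i ∧ η i = 0)}

/-- The finite family of polyhedra `domPiece ∩ kktCone`, indexed by all selections `mu` of one
dual vertex per generator and by all active sets `I`. -/
def pieceFamily (Q : Matrix (Fin m) (Fin m) ℝ) (D : Matrix (Fin k) (Fin m) ℝ)
    (L : Finset (Fin k) → ℕ)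
    (gen : (I : Finset (Fin k)) → Fin (L I) → (Fin m → ℝ) × (Fin k → ℝ)) :
    Set (Set ((Fin m → ℝ) × (Fin k → ℝ))) :=
  {S | ∃ (mu : (I : Finset (Fin k)) → Fin (L I) → (Fin k → ℝ)) (I' : Finset (Fin k)),
    (∀ I l, mu I l ∈ dualVertices Q D (gen I l).1) ∧
    S = domPiece D L gen mu ∩ kktCone Q D I'}

/-- The extended-real optimal value of the linear program `min cᵀ z` subject to
`A z = b`, `z ≥ 0`, as a function of the pair `(b, c)`. -/
def lpVal {r n : ℕ} (A : Matrix (Fin r) (Fin n) ℝ) (x : (Fin r → ℝ) × (Fin n → ℝ)) : EReal :=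
  ⨅ z ∈ {z : Fin n → ℝ | A *ᵥ z = x.1 ∧ 0 ≤ z}, ((x.2 ⬝ᵥ z : ℝ) : EReal)

/-- The domain of finiteness of the linear program. -/
def lpDom {r n : ℕ} (A : Matrix (Fin r) (Fin n) ℝ) : Set ((Fin r → ℝ) × (Fin n → ℝ)) :=
  {x | ⊥ < lpVal A x ∧ lpVal A x < ⊤}

/-- The real-valued optimal value function of the linear program; meaningful on `lpDom A`. -/
def lpOpt {r n : ℕ} (A : Matrix (Fin r) (Fin n) ℝ) (x : (Fin r → ℝ) × (Fin n → ℝ)) : ℝ :=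
  (lpVal A x).toReal

end QP

end

namespace QP

open Filter Topology Set

section DifferenceOfConvex

/-! ### Convexity from local support lines -/

/-! The analytic core is that a function on a convex set `C` which agrees with a quadratic function
on each member of a finite closed cover is dc (`isDCOn_of_finite_closed_cover`). Closedness makes
the function continuous on `C`, hence a continuous selection of finitely many quadratics. Adding one
nonnegative quadratic form makes every piece convex. The selection `g` of convex pieces `c i` may
still have concave kinks, but it becomes convex once `2 * max (c i) (c j)` is summed over all pairs:
when the active piece changes from `i₀` to `i`, the term of that pair repays the change of slope
(`local_support_selection`). On each segment this gives a local support line at every interior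
point, which together with continuity forces convexity (`le_chord_of_local_support`).

It remains to cover the domain of finiteness. Minima are attained there (`exists_isMin_of_bounded`,
Frank–Wolfe), so the KKT conditions hold and the cones `kktCone` cover. Each generator `(v, ξ)` of a
KKT recession cone has zero curvature, so boundedness below makes the slope along `v` nonnegative at
every feasible point; linear programming duality converts this into a vertex `μ`
(`exists_compensating_vertex`). Hence the concrete family covers.

For positive semidefinite `Q`, KKT points are minimizers, so the cones `kktCone` alone suffice as
pieces: on each of them the value is quadratic (`exists_quadratic_value`). The domain is convex,
being described by primal and dual feasibility. Linear programs in standard form are the case `Q =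
0` after a linear substitution of the data. -/

/-- A continuous function on `[0, 1]` that has a local support line at every interior point lies
below its chord. -/
theorem le_chord_of_local_support {φ : ℝ → ℝ} (hc : ContinuousOn φ (Icc 0 1))
    (hs : ∀ t ∈ Ioo (0 : ℝ) 1, ∃ s : ℝ, ∀ᶠ u in 𝓝 t, φ t + s * (u - t) ≤ φ u) :
    ∀ t ∈ Icc (0 : ℝ) 1, φ t ≤ (1 - t) * φ 0 + t * φ 1 := by
  intro t ht
  set ψ : ℝ → ℝ := fun t => φ t - ((1 - t) * φ 0 + t * φ 1) with hψ
  have hψc : ContinuousOn ψ (Icc 0 1) := hc.sub (by fun_prop)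
  by_contra! hlt
  obtain ⟨t₀, ht₀, hmax⟩ := isCompact_Icc.exists_isMaxOn ⟨t, ht⟩ hψc
  have hmax' : ∀ u ∈ Icc (0 : ℝ) 1, ψ u ≤ ψ t₀ := fun u hu => hmax hu
  have hpos : 0 < ψ t₀ := lt_of_lt_of_le (by simp only [hψ]; linarith) (hmax' t ht)
  -- The leftmost maximizer `a` of the gap is interior, as the gap vanishes at the endpoints. The
  -- support line at `a` gives `ψ (a + h) + ψ (a - h) ≥ 2 * ψ a`, so `a - h` would be a maximizer
  -- too.
  set A : Set ℝ := Icc 0 1 ∩ ψ ⁻¹' Ici (ψ t₀) with hA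
  have hAc : IsCompact A :=
    isCompact_Icc.of_isClosed_subset (hψc.preimage_isClosed_of_isClosed isClosed_Icc isClosed_Ici)
      inter_subset_left
  have ha : sInf A ∈ A := hAc.sInf_mem ⟨t₀, ht₀, le_refl (ψ t₀)⟩
  have hinf : ∀ u ∈ A, sInf A ≤ u := fun u hu => csInf_le hAc.bddBelow hu
  set a := sInf A with ha_def
  have haψ : ψ t₀ ≤ ψ a := ha.2
  have h0 : ψ 0 = 0 := by simp [hψ]
  have h1 : ψ 1 = 0 := by simp [hψ]
  have ha0 : 0 < a := lt_of_le_of_ne ha.1.1 (by intro h; rw [← h] at haψ; linarith)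
  have ha1 : a < 1 := lt_of_le_of_ne ha.1.2 (by intro h; rw [h] at haψ; linarith)
  obtain ⟨s, hs⟩ := hs a ⟨ha0, ha1⟩
  obtain ⟨ε, hε, hball⟩ := Metric.eventually_nhds_iff.1 hs
  obtain ⟨h, hh0, hh⟩ : ∃ h : ℝ, 0 < h ∧ h < min ε (min a (1 - a)) :=
    exists_between (by simp [hε, ha0, ha1])
  rw [lt_min_iff, lt_min_iff] at hh
  have e1 := hball (y := a + h) (by simp [abs_of_pos hh0, hh.1])
  have e2 := hball (y := a - h) (by simp [abs_of_pos hh0, hh.1])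
  have m1 := hmax' (a + h) ⟨by linarith, by linarith⟩
  have m2 : a - h ∈ A → False := fun hu => by linarith [hinf _ hu]
  refine m2 ⟨⟨by linarith, by linarith⟩, ?_⟩
  simp only [mem_preimage, mem_Ici]
  have m3 := hmax' a ha.1
  simp only [hψ] at *
  nlinarith

variable {E : Type*} [AddCommGroup E] [Module ℝ E]

/-- A function on a convex set that is continuous and locally supported by affine functions along
every segment is convex. -/
theorem convexOn_of_local_support {C : Set E} (hC : Convex ℝ C) {φ : E → ℝ}
    (hc : ∀ x ∈ C, ∀ y ∈ C, ContinuousOn (fun t : ℝ => φ (x + t • (y - x))) (Icc 0 1))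
    (hs : ∀ x ∈ C, ∀ y ∈ C, ∀ t ∈ Ioo (0 : ℝ) 1, ∃ s : ℝ, ∀ᶠ u in 𝓝 t,
      φ (x + t • (y - x)) + s * (u - t) ≤ φ (x + u • (y - x))) :
    ConvexOn ℝ C φ := by
  refine ⟨hC, fun x hx y hy a b ha hb hab => ?_⟩
  have h := le_chord_of_local_support (hc x hx y hy) (hs x hx y hy) b ⟨hb, by linarith⟩
  have e : a • x + b • y = x + b • (y - x) := by
    rw [← eq_sub_iff_add_eq] at hab
    rw [hab]; module
  rw [e]
  have ha' : 1 - b = a := by linarith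
  simpa [ha'] using h

/-! ### Quadratic functions -/

/-- A quadratic form on a finite-dimensional space is a weighted sum of squares of linear
coordinates. -/
theorem exists_sum_squares [FiniteDimensional ℝ E] (B : QuadraticForm ℝ E) :
    ∃ (n : ℕ) (w : Fin n → ℝ) (e : E →ₗ[ℝ] (Fin n → ℝ)), ∀ x, B x = ∑ i, w i * (e x i * e x i) := by
  obtain ⟨w, ⟨e⟩⟩ := QuadraticForm.equivalent_weightedSumSquares B
  refine ⟨_, w, e.toLinearEquiv.toLinearMap, fun x => ?_⟩
  have := e.map_app x
  rw [QuadraticMap.weightedSumSquares_apply] at this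
  simpa using this.symm

/-- Diagonalize `B` and replace the weights by their absolute values. -/
theorem exists_nonneg_dominating_form [FiniteDimensional ℝ E] (B : QuadraticForm ℝ E) :
    ∃ N : QuadraticForm ℝ E, (∀ x, 0 ≤ N x) ∧ ∀ x, 0 ≤ B x + N x := by
  obtain ⟨n, w, e, h⟩ := exists_sum_squares B
  have hN : ∀ x, ((QuadraticMap.weightedSumSquares ℝ fun i => |w i|).comp e) x =
      ∑ i, |w i| * (e x i * e x i) := fun x => by
    simp [QuadraticMap.weightedSumSquares_apply]
  refine ⟨(QuadraticMap.weightedSumSquares ℝ fun i => |w i|).comp e, fun x => ?_, fun x => ?_⟩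
  · rw [hN]
    exact Finset.sum_nonneg fun i _ => mul_nonneg (abs_nonneg _) (mul_self_nonneg _)
  · rw [h, hN, ← Finset.sum_add_distrib]
    refine Finset.sum_nonneg fun i _ => ?_
    rw [← add_mul]
    exact mul_nonneg (by linarith [neg_abs_le (w i)]) (mul_self_nonneg _)

theorem IsQuadraticFunction.continuous [TopologicalSpace E] [IsTopologicalAddGroup E]
    [ContinuousSMul ℝ E] [T2Space E] [FiniteDimensional ℝ E] {p : E → ℝ}
    (hp : IsQuadraticFunction p) : Continuous p := by
  obtain ⟨B, l, c, h⟩ := hp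
  obtain ⟨n, w, e, he⟩ := exists_sum_squares B
  have hl := l.continuous_of_finiteDimensional
  have hee := e.continuous_of_finiteDimensional
  have : p = fun x => ∑ i, w i * (e x i * e x i) + l x + c := funext fun x => by rw [h, he]
  rw [this]
  fun_prop

/-- Restriction of a quadratic function to a line. -/
theorem quadratic_line (B : QuadraticForm ℝ E) (l : E →ₗ[ℝ] ℝ) (c : ℝ) (x d : E) (t : ℝ) :
    B (x + t • d) + l (x + t • d) + c =
      (B x + l x + c) + t * (QuadraticMap.polar B x d + l d) + t ^ 2 * B d := by
  rw [QuadraticMap.map_add B, QuadraticMap.polar_smul_right, QuadraticMap.map_smul]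
  simp only [map_add, map_smul, smul_eq_mul]
  ring

/-- A quadratic function with nonnegative quadratic part has support lines along lines. -/
theorem quadratic_line_support {B : QuadraticForm ℝ E} (hB : ∀ x, 0 ≤ B x) (l : E →ₗ[ℝ] ℝ) (c : ℝ)
    (x d : E) (t : ℝ) : ∃ s : ℝ, ∀ u : ℝ,
      B (x + t • d) + l (x + t • d) + c + s * (u - t) ≤ B (x + u • d) + l (x + u • d) + c := by
  -- The slope is the derivative at `t`; the remainder is `(u - t) ^ 2 * B d`.
  refine ⟨QuadraticMap.polar B x d + l d + 2 * t * B d, fun u => ?_⟩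
  rw [quadratic_line, quadratic_line]
  nlinarith [mul_nonneg (sq_nonneg (u - t)) (hB d)]

/-! ### Continuous selections of quadratic functions -/

/-- Along a line, a continuous selection of supported functions becomes locally supported after the
pairwise maxima are added. -/
theorem local_support_selection {ι : Type*} [Fintype ι] {g : ℝ → ℝ} {c : ι → ℝ → ℝ} {t : ℝ}
    (hg : ContinuousAt g t) (hc : ∀ i, ContinuousAt (c i) t)
    (hsel : ∀ᶠ u in 𝓝 t, ∃ i, g u = c i u)
    (hsup : ∀ i, ∃ s : ℝ, ∀ u, c i t + s * (u - t) ≤ c i u) :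
    ∃ s : ℝ, ∀ᶠ u in 𝓝 t,
      g t + ∑ p : ι × ι, 2 * max (c p.1 t) (c p.2 t) + s * (u - t) ≤
        g u + ∑ p : ι × ι, 2 * max (c p.1 u) (c p.2 u) := by
  classical
  choose s hs using hsup
  obtain ⟨i₀, hi₀⟩ := hsel.self_of_nhds
  -- By continuity, a piece inactive at `t` stays inactive nearby.
  have hact : ∀ᶠ u in 𝓝 t, ∀ i, c i t ≠ g t → c i u ≠ g u := by
    rw [eventually_all]
    intro i
    by_cases h : c i t = g t
    · simp [h]
    · filter_upwards [((hc i).sub hg).eventually_ne (sub_ne_zero.2 h)] with u hu _ using sub_ne_zero.1 hu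
  -- Where two pieces agree at `t`, each slope supports their maximum, so the sum of the slopes
  -- supports twice the maximum.
  have hm : ∀ p : ι × ι, ∃ m : ℝ, (c p.1 t = c p.2 t → m = s p.1 + s p.2) ∧
      ∀ u, 2 * max (c p.1 t) (c p.2 t) + m * (u - t) ≤ 2 * max (c p.1 u) (c p.2 u) := by
    intro p
    rcases lt_trichotomy (c p.1 t) (c p.2 t) with h | h | h
    · refine ⟨2 * s p.2, fun h' => absurd h' h.ne, fun u => ?_⟩
      rw [max_eq_right h.le]
      linarith [hs p.2 u, le_max_right (c p.1 u) (c p.2 u)]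
    · refine ⟨s p.1 + s p.2, fun _ => rfl, fun u => ?_⟩
      rw [max_eq_right h.le]
      have h1 := hs p.1 u
      have h2 := hs p.2 u
      rw [h] at h1
      linarith [le_max_right (c p.1 u) (c p.2 u), le_max_left (c p.1 u) (c p.2 u)]
    · refine ⟨2 * s p.1, fun h' => absurd h' h.ne', fun u => ?_⟩
      rw [max_eq_left h.le]
      linarith [hs p.1 u, le_max_left (c p.1 u) (c p.2 u)]
  choose m hmeq hm using hm
  refine ⟨s i₀ + ∑ p, m p, ?_⟩
  filter_upwards [hact, hsel] with u hu ⟨i, hi⟩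
  have hit : c i t = g t := by
    by_contra h
    exact hu i h hi.symm
  -- Every summand on the right is nonnegative, and the one for `(i, i₀)` alone dominates the left
  -- side, since the maximum there is at least `c i₀ u`.
  have key : s i₀ * (u - t) - s i * (u - t) ≤
      ∑ p : ι × ι, (2 * max (c p.1 u) (c p.2 u) - 2 * max (c p.1 t) (c p.2 t) - m p * (u - t)) := by
    refine le_trans ?_ (Finset.single_le_sum
      (f := fun p : ι × ι => 2 * max (c p.1 u) (c p.2 u) - 2 * max (c p.1 t) (c p.2 t) -
        m p * (u - t)) (fun p _ => by linarith [hm p u]) (Finset.mem_univ (i, i₀)))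
    have e : c i t = c i₀ t := by rw [hit, hi₀]
    simp only
    rw [hmeq (i, i₀) e, e, max_self]
    linarith [hs i₀ u, le_max_right (c i u) (c i₀ u)]
  simp only [Finset.sum_sub_distrib, ← Finset.sum_mul] at key
  have := hs i u
  rw [hit, ← hi] at this
  linarith

theorem IsDCOn.comp_linearMap {E' : Type*} [AddCommGroup E'] [Module ℝ E'] {s : Set E} {f : E → ℝ}
    (h : IsDCOn s f) (T : E' →ₗ[ℝ] E) : IsDCOn (T ⁻¹' s) (f ∘ T) := by
  obtain ⟨g, h, hg, hh, e⟩ := h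
  exact ⟨g ∘ T, h ∘ T, hg.comp_linearMap T, hh.comp_linearMap T, fun x hx => e _ hx⟩

variable [TopologicalSpace E] [IsTopologicalAddGroup E] [ContinuousSMul ℝ E] [T2Space E]
  [FiniteDimensional ℝ E]

/-- A continuous selection of finitely many quadratic functions on a convex set is dc. -/
theorem isDCOn_of_continuous_selection {ι : Type*} [Finite ι] {C : Set E} (hC : Convex ℝ C)
    {f : E → ℝ} (hf : ContinuousOn f C) (p : ι → E → ℝ) (hp : ∀ i, IsQuadraticFunction (p i))
    (hsel : ∀ x ∈ C, ∃ i, f x = p i x) : IsDCOn C f := by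
  have := Fintype.ofFinite ι
  have hpc := fun i => (hp i).continuous
  choose B l a hp using hp
  choose N hN0 hN using fun i => exists_nonneg_dominating_form (B i)
  set σ : E → ℝ := fun x => (∑ i, N i) x with hσ
  have hσ0 : ∀ x, 0 ≤ (∑ i, N i) x := fun x => by
    rw [sum_apply]; exact Finset.sum_nonneg fun i _ => hN0 i x
  have hσc : Continuous σ :=
    IsQuadraticFunction.continuous ⟨∑ i, N i, 0, 0, fun x => by simp [hσ]⟩
  set c : ι → E → ℝ := fun i x => p i x + σ x with hc
  have hcB : ∀ i x, c i x = (B i + ∑ j, N j) x + l i x + a i := fun i x => by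
    simp only [hc, hp, hσ, add_apply]; ring
  have hB0 : ∀ i x, 0 ≤ (B i + ∑ j, N j) x := fun i x => by
    rw [add_apply, sum_apply]
    refine (hN i x).trans ?_
    gcongr
    exact Finset.single_le_sum (f := fun j => N j x) (fun j _ => hN0 j x) (Finset.mem_univ i)
  have hcc : ∀ i, Continuous (c i) := fun i => (hpc i).add hσc
  have hsup : ∀ i x d (t : ℝ), ∃ s : ℝ, ∀ u : ℝ,
      c i (x + t • d) + s * (u - t) ≤ c i (x + u • d) := fun i x d t => by
    simp only [hcB]
    exact quadratic_line_support (hB0 i) (l i) (a i) x d t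
  have hcconv : ∀ i, ConvexOn ℝ C (c i) := fun i =>
    convexOn_of_local_support hC
      (fun x _ y _ => ((hcc i).comp (by fun_prop)).continuousOn)
      (fun x _ y _ t _ => (hsup i x (y - x) t).imp fun s hs => Eventually.of_forall hs)
  have hσconv : ConvexOn ℝ C σ :=
    convexOn_of_local_support hC (fun x _ y _ => (hσc.comp (by fun_prop)).continuousOn)
      (fun x _ y _ t _ => by
        obtain ⟨s, hs⟩ := quadratic_line_support hσ0 0 0 x (y - x) t
        exact ⟨s, Eventually.of_forall fun u => by simpa [hσ] using hs u⟩)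
  set G : E → ℝ := fun x => ∑ q : ι × ι, 2 * max (c q.1 x) (c q.2 x) with hG
  have hGc : Continuous G := by fun_prop
  have hGconv : ConvexOn ℝ C G := by
    have : ∀ s : Finset (ι × ι), ConvexOn ℝ C fun x => ∑ q ∈ s, 2 * max (c q.1 x) (c q.2 x) := by
      classical
      intro s
      induction s using Finset.induction_on with
      | empty => simpa using convexOn_const (0 : ℝ) hC
      | insert q s hq ih =>
        simp only [Finset.sum_insert hq]
        exact (((hcconv q.1).sup (hcconv q.2)).smul (c := (2 : ℝ)) zero_le_two).add ih
    exact this _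
  have hline : ∀ x ∈ C, ∀ y ∈ C, MapsTo (fun t : ℝ => x + t • (y - x)) (Icc 0 1) C :=
    fun x hx y hy t ht => hC.add_smul_sub_mem hx hy ht
  have hfl : ∀ x ∈ C, ∀ y ∈ C,
      ContinuousOn (fun t : ℝ => f (x + t • (y - x)) + σ (x + t • (y - x))) (Icc 0 1) :=
    fun x hx y hy => (hf.add hσc.continuousOn).comp
      (Continuous.continuousOn (by fun_prop)) (hline x hx y hy)
  refine ⟨fun x => f x + σ x + G x, fun x => G x + σ x, ?_, hGconv.add hσconv,
    fun x _ => by ring⟩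
  refine convexOn_of_local_support hC (fun x hx y hy => (hfl x hx y hy).add
    (hGc.comp (by fun_prop)).continuousOn) (fun x hx y hy t ht => ?_)
  refine local_support_selection (g := fun t : ℝ => f (x + t • (y - x)) + σ (x + t • (y - x)))
    (c := fun i t => c i (x + t • (y - x)))
    ((hfl x hx y hy).continuousAt (Icc_mem_nhds ht.1 ht.2))
    (fun i => ((hcc i).comp (by fun_prop)).continuousAt) ?_ (fun i => hsup i x (y - x) t)
  filter_upwards [Icc_mem_nhds ht.1 ht.2] with u hu
  obtain ⟨i, hi⟩ := hsel _ (hline x hx y hy hu)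
  exact ⟨i, by simp only [hc, hi]⟩

/-- A function that is quadratic on each member of a finite closed cover of a convex set is dc
there. -/
theorem isDCOn_of_finite_closed_cover {C : Set E} (hC : Convex ℝ C) {f : E → ℝ}
    {F : Set (Set E)} (hF : F.Finite) (hcl : ∀ S ∈ F, IsClosed S) (hcov : C ⊆ ⋃₀ F)
    (hq : ∀ S ∈ F, ∃ p : E → ℝ, IsQuadraticFunction p ∧ ∀ x ∈ S ∩ C, f x = p x) :
    IsDCOn C f := by
  choose p hp hpf using fun S : F => hq S.1 S.2
  have := hF.to_subtype
  refine isDCOn_of_continuous_selection hC ?_ p hp fun x hx => ?_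
  · intro x hx
    -- Pasting over a finite cover: members containing `x` carry a continuous quadratic, and closed
    -- members missing `x` contribute the trivial filter.
    have hle : 𝓝[C] x ≤ ⨆ S ∈ F, 𝓝[S ∩ C] x := by
      rw [← nhdsWithin_biUnion hF, ← Set.iUnion₂_inter, ← sUnion_eq_biUnion]
      exact nhdsWithin_mono x fun y hy => ⟨hcov hy, hy⟩
    refine Tendsto.mono_left ?_ hle
    simp only [tendsto_iSup]
    intro S hS
    by_cases hxS : x ∈ S
    · have h1 : ContinuousWithinAt (p ⟨S, hS⟩) (S ∩ C) x := (hp _).continuous.continuousWithinAt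
      exact h1.congr (fun y hy => hpf ⟨S, hS⟩ y hy) (hpf ⟨S, hS⟩ x ⟨hxS, hx⟩)
    · have : 𝓝[S ∩ C] x = ⊥ := by
        rw [← notMem_closure_iff_nhdsWithin_eq_bot]
        exact fun h => hxS ((hcl S hS).closure_subset (closure_mono inter_subset_left h))
      rw [this]
      exact tendsto_bot
  · obtain ⟨S, hS, hxS⟩ := hcov hx
    exact ⟨⟨S, hS⟩, hpf ⟨S, hS⟩ x ⟨hxS, hx⟩⟩

theorem IsPolyhedron.isClosed {s : Set E} (hs : IsPolyhedron s) : IsClosed s := by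
  obtain ⟨n, a, β, rfl⟩ := hs
  simp only [ofPred_forall]
  exact isClosed_iInter fun i =>
    isClosed_le (a i).continuous_of_finiteDimensional continuous_const

end DifferenceOfConvex

/-! ### Attainment in quadratic programming -/

section FrankWolfe

variable {ι κ : Type*} [Fintype ι]

theorem objective_add_smul {Q : Matrix ι ι ℝ} (hQ : Q.IsSymm) (q z v : ι → ℝ) (t : ℝ) :
    q ⬝ᵥ (z + t • v) + 1 / 2 * ((z + t • v) ⬝ᵥ (Q *ᵥ (z + t • v))) =
      (q ⬝ᵥ z + 1 / 2 * (z ⬝ᵥ (Q *ᵥ z))) + t * ((q + Q *ᵥ z) ⬝ᵥ v) +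
        1 / 2 * t ^ 2 * (v ⬝ᵥ (Q *ᵥ v)) := by
  have h : z ⬝ᵥ (Q *ᵥ v) = v ⬝ᵥ (Q *ᵥ z) := by
    rw [Matrix.dotProduct_mulVec, ← Matrix.mulVec_transpose, hQ.eq, dotProduct_comm]
  simp only [Matrix.mulVec_add, Matrix.mulVec_smul, dotProduct_add, add_dotProduct,
    dotProduct_smul, smul_dotProduct, smul_eq_mul, h, dotProduct_comm (Q *ᵥ z) v]
  ring

theorem continuous_dotProduct {X : Type*} [TopologicalSpace X] {f g : X → ι → ℝ}
    (hf : Continuous f) (hg : Continuous g) : Continuous fun x => f x ⬝ᵥ g x := by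
  fun_prop

theorem norm_sq_le_dotProduct (z : ι → ℝ) : ‖z‖ ^ 2 ≤ z ⬝ᵥ z := by
  have h0 : 0 ≤ z ⬝ᵥ z := Finset.sum_nonneg fun i _ => mul_self_nonneg (z i)
  have : ‖z‖ ≤ √(z ⬝ᵥ z) := by
    rw [pi_norm_le_iff_of_nonneg (Real.sqrt_nonneg _)]
    intro i
    rw [Real.norm_eq_abs]
    refine Real.abs_le_sqrt ?_
    rw [sq]
    exact Finset.single_le_sum (f := fun i => z i * z i) (fun i _ => mul_self_nonneg (z i))
      (Finset.mem_univ i)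
  calc ‖z‖ ^ 2 ≤ √(z ⬝ᵥ z) ^ 2 := by gcongr
    _ = z ⬝ᵥ z := Real.sq_sqrt h0

/-- A nonempty closed set has an element of least Euclidean norm. -/
theorem exists_min_dotProduct_self {S : Set (ι → ℝ)} (hS : IsClosed S) (hne : S.Nonempty) :
    ∃ z ∈ S, ∀ y ∈ S, z ⬝ᵥ z ≤ y ⬝ᵥ y := by
  obtain ⟨z₀, hz₀⟩ := hne
  have hf : Continuous fun z : ι → ℝ => z ⬝ᵥ z := by fun_prop
  have hK : IsCompact (S ∩ {z | z ⬝ᵥ z ≤ z₀ ⬝ᵥ z₀}) := by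
    refine (isCompact_closedBall (0 : ι → ℝ) (√(z₀ ⬝ᵥ z₀))).of_isClosed_subset
      (hS.inter (isClosed_le hf continuous_const)) fun z hz => ?_
    rw [mem_closedBall_zero_iff]
    exact Real.le_sqrt_of_sq_le ((norm_sq_le_dotProduct z).trans hz.2)
  obtain ⟨z, hz, hmin⟩ := hK.exists_isMinOn ⟨z₀, hz₀, le_refl (z₀ ⬝ᵥ z₀)⟩ hf.continuousOn
  refine ⟨z, hz.1, fun y hy => ?_⟩
  by_cases h : y ⬝ᵥ y ≤ z₀ ⬝ᵥ z₀
  · exact hmin ⟨hy, h⟩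
  · exact le_trans hz.2 (not_le.1 h).le

/-- If a quadratic objective is bounded below on a polyhedron, then its slope at any feasible point
along a recession direction of nonpositive curvature is nonnegative. -/
theorem slope_nonneg_of_bounded {Q : Matrix ι ι ℝ} (hQ : Q.IsSymm) {q : ι → ℝ} {D : Matrix κ ι ℝ}
    {b : κ → ℝ} {β : ℝ} (hβ : ∀ z, b ≤ D *ᵥ z → β ≤ q ⬝ᵥ z + 1 / 2 * (z ⬝ᵥ (Q *ᵥ z)))
    {v : ι → ℝ} (hv : 0 ≤ D *ᵥ v) (hcurv : v ⬝ᵥ (Q *ᵥ v) ≤ 0) {z : ι → ℝ} (hz : b ≤ D *ᵥ z) :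
    0 ≤ (q + Q *ᵥ z) ⬝ᵥ v := by
  by_contra! hneg
  set s := (q + Q *ᵥ z) ⬝ᵥ v with hs
  set f := q ⬝ᵥ z + 1 / 2 * (z ⬝ᵥ (Q *ᵥ z)) with hf
  have hfβ : β ≤ f := hβ z hz
  -- At this step length the linear term alone brings the objective to `β - 1`.
  set t : ℝ := (f - β + 1) / (-s) with ht
  have ht0 : 0 ≤ t := div_nonneg (by linarith) (by linarith)
  have h := hβ (z + t • v) (by
    rw [Matrix.mulVec_add, Matrix.mulVec_smul]
    exact hz.trans (le_add_of_nonneg_right (smul_nonneg ht0 hv)))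
  rw [objective_add_smul hQ] at h
  have hts : t * s = -(f - β + 1) := by rw [ht, div_neg, neg_mul, div_mul_cancel₀ _ hneg.ne]
  have : 1 / 2 * t ^ 2 * (v ⬝ᵥ (Q *ᵥ v)) ≤ 0 :=
    mul_nonpos_of_nonneg_of_nonpos (by positivity) hcurv
  linarith

variable [Fintype κ]

/-- The step `z - t v` shortens a long feasible vector `z` close to the direction `v` and keeps it
feasible. -/
theorem exists_shortening_step {D : Matrix κ ι ℝ} {b : κ → ℝ} {z v : ι → ℝ} (hz : b ≤ D *ᵥ z)
    (hzv : 0 < z ⬝ᵥ v) (hD : ∀ i, (D *ᵥ v) i = 0 ∨ b i < (D *ᵥ z) i) :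
    ∃ t : ℝ, 0 < t ∧ b ≤ D *ᵥ (z + (-t) • v) ∧
      (z + (-t) • v) ⬝ᵥ (z + (-t) • v) < z ⬝ᵥ z := by
  have h1 : ∀ᶠ t : ℝ in 𝓝[>] 0, ∀ i, b i ≤ (D *ᵥ (z + (-t) • v)) i := by
    rw [eventually_all]
    intro i
    simp only [Matrix.mulVec_add, Matrix.mulVec_smul, Pi.add_apply, Pi.smul_apply, smul_eq_mul]
    rcases hD i with h | h
    · simp only [h, mul_zero, add_zero]
      exact Eventually.of_forall fun _ => hz i
    · have hc : ContinuousAt (fun t : ℝ => (D *ᵥ z) i + -t * (D *ᵥ v) i) 0 := by fun_prop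
      have := hc.eventually (lt_mem_nhds (a := b i) (by simpa using h))
      exact (this.filter_mono nhdsWithin_le_nhds).mono fun t ht => ht.le
  have h2 : ∀ᶠ t : ℝ in 𝓝[>] 0, t * (v ⬝ᵥ v) < 2 * (z ⬝ᵥ v) := by
    have hc : ContinuousAt (fun t : ℝ => t * (v ⬝ᵥ v)) 0 := by fun_prop
    exact (Tendsto.eventually_lt_const (u := 2 * (z ⬝ᵥ v)) (by simpa using hzv) hc).filter_mono
      nhdsWithin_le_nhds
  obtain ⟨t, ht1, ht2, ht0⟩ := (h1.and (h2.and self_mem_nhdsWithin)).exists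
  refine ⟨t, ht0, ht1, ?_⟩
  have ht0' : 0 < t := ht0
  simp only [dotProduct_add, add_dotProduct, dotProduct_smul, smul_dotProduct, smul_eq_mul,
    dotProduct_comm v z]
  nlinarith

/-- The **Frank–Wolfe theorem**: a quadratic objective that is bounded below on a nonempty
polyhedron attains its minimum there. -/
theorem exists_isMin_of_bounded {Q : Matrix ι ι ℝ} (hQ : Q.IsSymm) (q : ι → ℝ) (D : Matrix κ ι ℝ)
    (b : κ → ℝ) (hne : ∃ z, b ≤ D *ᵥ z) {β : ℝ}
    (hβ : ∀ z, b ≤ D *ᵥ z → β ≤ q ⬝ᵥ z + 1 / 2 * (z ⬝ᵥ (Q *ᵥ z))) :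
    ∃ z, b ≤ D *ᵥ z ∧ ∀ y, b ≤ D *ᵥ y →
      q ⬝ᵥ z + 1 / 2 * (z ⬝ᵥ (Q *ᵥ z)) ≤ q ⬝ᵥ y + 1 / 2 * (y ⬝ᵥ (Q *ᵥ y)) := by
  set f : (ι → ℝ) → ℝ := fun z => q ⬝ᵥ z + 1 / 2 * (z ⬝ᵥ (Q *ᵥ z)) with hf
  have hfc : Continuous f := by fun_prop
  set P : Set (ι → ℝ) := {z | b ≤ D *ᵥ z} with hP
  have hPc : IsClosed P := isClosed_le continuous_const (by fun_prop)
  have hbdd : BddBelow (f '' P) := ⟨β, by rintro _ ⟨z, hz, rfl⟩; exact hβ z hz⟩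
  obtain ⟨α, hαanti, hαlim, hαmem⟩ := exists_seq_tendsto_sInf (Set.Nonempty.image f hne) hbdd
  have hinf : ∀ y ∈ P, sInf (f '' P) ≤ f y := fun y hy => csInf_le hbdd ⟨y, hy, rfl⟩
  -- Least-norm points of the sublevel sets: if they escape to infinity, a step back along their
  -- limit direction will contradict their minimality.
  have hmin : ∀ n, ∃ z ∈ P ∩ {z | f z ≤ α n}, ∀ y ∈ P ∩ {z | f z ≤ α n}, z ⬝ᵥ z ≤ y ⬝ᵥ y := by
    intro n
    refine exists_min_dotProduct_self (hPc.inter (isClosed_le hfc continuous_const)) ?_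
    obtain ⟨z, hz, hzα⟩ := hαmem n
    exact ⟨z, hz, hzα.le⟩
  choose z hz hzmin using hmin
  by_cases hfreq : ∃ R : ℝ, ∃ᶠ n in atTop, z n ∈ Metric.closedBall (0 : ι → ℝ) R
  · obtain ⟨R, hR⟩ := hfreq
    obtain ⟨a, -, φ, hφ, hlim⟩ := (isCompact_closedBall (0 : ι → ℝ) R).tendsto_subseq' hR
    refine ⟨a, hPc.mem_of_tendsto hlim (Eventually.of_forall fun n => (hz (φ n)).1), fun y hy => ?_⟩
    have h1 : f a ≤ sInf (f '' P) :=
      le_of_tendsto_of_tendsto' ((hfc.tendsto a).comp hlim) (hαlim.comp hφ.tendsto_atTop)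
        fun n => (hz (φ n)).2
    exact h1.trans (hinf y hy)
  exfalso
  have hnorm : Tendsto (fun n => ‖z n‖) atTop atTop := by
    rw [tendsto_atTop]
    intro R
    have := not_exists.1 hfreq R
    rw [not_frequently] at this
    filter_upwards [this] with n hn
    rw [mem_closedBall_zero_iff, not_le] at hn
    exact hn.le
  have hsph : ∃ᶠ n in atTop, ‖z n‖⁻¹ • z n ∈ Metric.sphere (0 : ι → ℝ) 1 := by
    refine Eventually.frequently ?_
    filter_upwards [hnorm.eventually_gt_atTop 0] with n hn
    rw [mem_sphere_zero_iff_norm, norm_smul, norm_inv, norm_norm, inv_mul_cancel₀ hn.ne']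
  obtain ⟨v, hv1, φ, hφ, hlim⟩ := (isCompact_sphere (0 : ι → ℝ) 1).tendsto_subseq' hsph
  rw [mem_sphere_zero_iff_norm] at hv1
  have hinv : Tendsto (fun n => ‖z (φ n)‖⁻¹) atTop (𝓝 0) :=
    (tendsto_inv_atTop_zero.comp hnorm).comp hφ.tendsto_atTop
  have hpos : ∀ᶠ n in atTop, 0 < ‖z (φ n)‖ :=
    (hnorm.comp hφ.tendsto_atTop).eventually_gt_atTop 0
  have hDlim : Tendsto (fun n => D *ᵥ (‖z (φ n)‖⁻¹ • z (φ n)) - ‖z (φ n)‖⁻¹ • b) atTop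
      (𝓝 (D *ᵥ v)) := by
    have hDc : Continuous fun z : ι → ℝ => D *ᵥ z := by fun_prop
    simpa using ((hDc.tendsto v).comp hlim).sub (hinv.smul_const b)
  have hDeq : ∀ n, D *ᵥ (‖z (φ n)‖⁻¹ • z (φ n)) - ‖z (φ n)‖⁻¹ • b =
      ‖z (φ n)‖⁻¹ • (D *ᵥ z (φ n) - b) := fun n => by
    rw [Matrix.mulVec_smul, smul_sub]
  simp only [hDeq] at hDlim
  have hDv : 0 ≤ D *ᵥ v := ge_of_tendsto' hDlim fun n =>
    smul_nonneg (by positivity) (sub_nonneg.2 (hz (φ n)).1)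
  -- Divide `f z ≤ α 0` by `‖z‖ ^ 2`; the linear term and the right side vanish in the limit.
  have hcurv : v ⬝ᵥ (Q *ᵥ v) ≤ 0 := by
    have hQc : Continuous fun z : ι → ℝ => 1 / 2 * (z ⬝ᵥ (Q *ᵥ z)) := by fun_prop
    have hqc : Continuous fun z : ι → ℝ => q ⬝ᵥ z := by fun_prop
    have h1 : Tendsto (fun n => ‖z (φ n)‖⁻¹ * (q ⬝ᵥ (‖z (φ n)‖⁻¹ • z (φ n))) +
        1 / 2 * ((‖z (φ n)‖⁻¹ • z (φ n)) ⬝ᵥ (Q *ᵥ (‖z (φ n)‖⁻¹ • z (φ n))))) atTop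
        (𝓝 (0 * (q ⬝ᵥ v) + 1 / 2 * (v ⬝ᵥ (Q *ᵥ v)))) :=
      (hinv.mul ((hqc.tendsto v).comp hlim)).add ((hQc.tendsto v).comp hlim)
    have h2 : Tendsto (fun n => ‖z (φ n)‖⁻¹ * ‖z (φ n)‖⁻¹ * α 0) atTop (𝓝 (0 * 0 * α 0)) :=
      (hinv.mul hinv).mul_const _
    have h3 := le_of_tendsto_of_tendsto' h1 h2 fun n => by
      have h4 : f (z (φ n)) ≤ α 0 := (hz (φ n)).2.trans (hαanti (Nat.zero_le _))
      have h5 : ‖z (φ n)‖⁻¹ * ‖z (φ n)‖⁻¹ * f (z (φ n)) ≤ ‖z (φ n)‖⁻¹ * ‖z (φ n)‖⁻¹ * α 0 := by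
        gcongr
      refine le_trans (le_of_eq ?_) h5
      simp only [hf, Matrix.mulVec_smul, dotProduct_smul, smul_dotProduct, smul_eq_mul]
      ring
    linarith
  have hvv : 0 < v ⬝ᵥ v := by
    have := norm_sq_le_dotProduct v
    rw [hv1] at this
    linarith
  have hdir : ∀ᶠ n in atTop, 0 < z (φ n) ⬝ᵥ v := by
    have hc : Continuous fun z : ι → ℝ => z ⬝ᵥ v := by fun_prop
    filter_upwards [Tendsto.eventually_const_lt hvv ((hc.tendsto v).comp hlim), hpos] with n hn hn0
    simp only [Function.comp_apply, smul_dotProduct, smul_eq_mul] at hn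
    exact (mul_pos_iff_of_pos_left (inv_pos.2 hn0)).1 hn
  have hslack : ∀ᶠ n in atTop, ∀ i, (D *ᵥ v) i = 0 ∨ b i < (D *ᵥ z (φ n)) i := by
    rw [eventually_all]
    intro i
    rcases (hDv i).eq_or_lt with h | h
    · exact Eventually.of_forall fun _ => Or.inl h.symm
    · filter_upwards [Tendsto.eventually_const_lt h (tendsto_pi_nhds.1 hDlim i), hpos] with n hn hn0
      simp only [Pi.smul_apply, Pi.sub_apply, smul_eq_mul] at hn
      exact Or.inr (sub_pos.1 ((mul_pos_iff_of_pos_left (inv_pos.2 hn0)).1 hn))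
  obtain ⟨n, hn1, hn2⟩ := (hdir.and hslack).exists
  obtain ⟨t, ht0, htP, htlt⟩ := exists_shortening_step (hz (φ n)).1 hn1 hn2
  -- Nonnegative slope and nonpositive curvature along `v` mean that stepping backwards does not
  -- raise the objective, so the shorter point lies in the same sublevel set.
  have hslope := slope_nonneg_of_bounded hQ hβ hDv hcurv (hz (φ n)).1
  refine absurd (hzmin (φ n) (z (φ n) + (-t) • v) ⟨htP, ?_⟩) (not_le.2 htlt)
  change f (z (φ n) + (-t) • v) ≤ α (φ n)
  have hle : f (z (φ n)) ≤ α (φ n) := (hz (φ n)).2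
  refine le_trans ?_ hle
  simp only [hf]
  rw [objective_add_smul hQ]
  have h1 : 0 ≤ t * ((q + Q *ᵥ z (φ n)) ⬝ᵥ v) := mul_nonneg ht0.le hslope
  have h2 : 1 / 2 * (-t) ^ 2 * (v ⬝ᵥ (Q *ᵥ v)) ≤ 0 :=
    mul_nonpos_of_nonneg_of_nonpos (by positivity) hcurv
  linarith

end FrankWolfe

/-! ### Finitely generated cones, the Farkas lemma and multipliers -/

section Cones

variable {ι κ : Type*} [Fintype κ]

/-- A polyhedron in standard form has finitely many vertices. -/
theorem finite_extremePoints_standard (M : Matrix ι κ ℝ) (c : ι → ℝ) :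
    (extremePoints ℝ {μ : κ → ℝ | 0 ≤ μ ∧ M *ᵥ μ = c}).Finite := by
  refine Set.Finite.of_injOn (f := fun μ : κ → ℝ => {i | μ i ≠ 0}) (t := univ)
    (fun _ _ => mem_univ _) ?_ finite_univ
  intro μ hμ ν hν hsupp
  have hs : ∀ i, μ i = 0 → ν i = 0 := fun i hi => by
    by_contra h
    have : i ∈ {i | μ i ≠ 0} := by rw [show {i | μ i ≠ 0} = {i | ν i ≠ 0} from hsupp]; exact h
    exact this hi
  -- A vertex is determined by its support: with equal supports, the segment from `ν` to `μ` extends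
  -- beyond `μ` inside the polyhedron.
  have hev : ∀ᶠ t : ℝ in 𝓝[>] 0, ∀ i, 0 ≤ (μ - t • (ν - μ)) i := by
    rw [eventually_all]
    intro i
    simp only [Pi.sub_apply, Pi.smul_apply, smul_eq_mul]
    rcases (hμ.1.1 i).eq_or_lt with h | h
    · have h0 : μ i = 0 := h.symm
      simp [h0, hs i h0]
    · have hc : ContinuousAt (fun t : ℝ => μ i - t * (ν i - μ i)) 0 := by fun_prop
      have := Tendsto.eventually_const_lt (u := (0 : ℝ)) (by simpa using h) hc
      exact (this.filter_mono nhdsWithin_le_nhds).mono fun t ht => ht.le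
  obtain ⟨t, ht, ht0⟩ := (hev.and self_mem_nhdsWithin).exists
  have ht0' : 0 < t := ht0
  refine ((mem_extremePoints.1 hμ).2 (μ - t • (ν - μ)) ⟨ht, ?_⟩ ν hν.1 ?_).2.symm
  · rw [Matrix.mulVec_sub, Matrix.mulVec_smul, Matrix.mulVec_sub, hμ.1.2, hν.1.2, sub_self,
      smul_zero, sub_zero]
  · refine ⟨1 / (1 + t), t / (1 + t), by positivity, by positivity, by field_simp, ?_⟩
    ext i
    simp only [Pi.add_apply, Pi.sub_apply, Pi.smul_apply, smul_eq_mul]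
    field_simp
    ring

variable [Fintype ι]

/-- For `c` in the closure, Frank–Wolfe attains the minimum of `|M w - c|²` over `w ≥ 0`, and that
minimum is zero. -/
theorem isClosed_mulVec_orthant (M : Matrix κ ι ℝ) :
    IsClosed {c : κ → ℝ | ∃ w : ι → ℝ, 0 ≤ w ∧ M *ᵥ w = c} := by
  classical
  rw [← closure_subset_iff_isClosed]
  intro c hc
  have hQ : ((2 : ℝ) • (Mᵀ * M)).IsSymm := by
    simp [Matrix.IsSymm, Matrix.transpose_smul, Matrix.transpose_mul]
  have hobj : ∀ w : ι → ℝ, ((-2 : ℝ) • (Mᵀ *ᵥ c)) ⬝ᵥ w +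
      1 / 2 * (w ⬝ᵥ (((2 : ℝ) • (Mᵀ * M)) *ᵥ w)) = (M *ᵥ w - c) ⬝ᵥ (M *ᵥ w - c) - c ⬝ᵥ c := by
    intro w
    have h1 : (Mᵀ *ᵥ c) ⬝ᵥ w = c ⬝ᵥ (M *ᵥ w) := by
      rw [Matrix.mulVec_transpose, Matrix.dotProduct_mulVec]
    have h2 : w ⬝ᵥ ((Mᵀ * M) *ᵥ w) = (M *ᵥ w) ⬝ᵥ (M *ᵥ w) := by
      rw [← Matrix.mulVec_mulVec, Matrix.dotProduct_mulVec, Matrix.vecMul_transpose]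
    simp only [Matrix.smul_mulVec, smul_dotProduct, dotProduct_smul, h1, h2, smul_eq_mul,
      dotProduct_sub, sub_dotProduct, dotProduct_comm (M *ᵥ w) c]
    ring
  have hnn : ∀ x : κ → ℝ, 0 ≤ x ⬝ᵥ x := fun x => Finset.sum_nonneg fun i _ => mul_self_nonneg (x i)
  obtain ⟨w, hw, hmin⟩ := exists_isMin_of_bounded hQ ((-2 : ℝ) • (Mᵀ *ᵥ c)) (1 : Matrix ι ι ℝ) 0
    ⟨0, by simp⟩ (β := -(c ⬝ᵥ c)) fun z _ => by rw [hobj]; linarith [hnn (M *ᵥ z - c)]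
  simp only [hobj, Matrix.one_mulVec] at hw hmin
  obtain ⟨x, hx, hlim⟩ := mem_closure_iff_seq_limit.1 hc
  have hcont : Continuous fun x : κ → ℝ => (x - c) ⬝ᵥ (x - c) := by fun_prop
  have h0 : (M *ᵥ w - c) ⬝ᵥ (M *ᵥ w - c) ≤ (c - c) ⬝ᵥ (c - c) := by
    refine ge_of_tendsto' ((hcont.tendsto c).comp hlim) fun n => ?_
    obtain ⟨y, hy, hyx⟩ := hx n
    have := hmin y hy
    simp only [Function.comp_apply, ← hyx]
    linarith
  rw [sub_self, zero_dotProduct] at h0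
  exact ⟨w, hw, sub_eq_zero.1 (dotProduct_self_eq_zero.1 (le_antisymm h0 (hnn _)))⟩

/-- A linear image of a nonnegative orthant is closed. -/
theorem isClosed_image_orthant {E : Type*} [AddCommGroup E] [Module ℝ E] [TopologicalSpace E]
    [IsTopologicalAddGroup E] [ContinuousSMul ℝ E] [T2Space E] [FiniteDimensional ℝ E]
    (T : (ι → ℝ) →ₗ[ℝ] E) : IsClosed {x : E | ∃ w : ι → ℝ, 0 ≤ w ∧ T w = x} := by
  classical
  let e := (Module.finBasis ℝ E).equivFun
  have he : Continuous e := e.toLinearMap.continuous_of_finiteDimensional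
  convert (isClosed_mulVec_orthant (LinearMap.toMatrix' (e.toLinearMap ∘ₗ T))).preimage he using 1
  ext x
  simp [LinearMap.toMatrix'_mulVec]

/-- The **Farkas lemma**. -/
theorem farkas (M : Matrix κ ι ℝ) (c : κ → ℝ)
    (h : ∀ y : κ → ℝ, 0 ≤ Mᵀ *ᵥ y → 0 ≤ c ⬝ᵥ y) : ∃ w : ι → ℝ, 0 ≤ w ∧ M *ᵥ w = c := by
  classical
  by_contra hc
  have hconv : Convex ℝ {c : κ → ℝ | ∃ w : ι → ℝ, 0 ≤ w ∧ M *ᵥ w = c} := by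
    rintro _ ⟨x, hx, rfl⟩ _ ⟨y, hy, rfl⟩ a b ha hb _
    exact ⟨a • x + b • y, add_nonneg (smul_nonneg ha hx) (smul_nonneg hb hy), by
      rw [Matrix.mulVec_add, Matrix.mulVec_smul, Matrix.mulVec_smul]⟩
  obtain ⟨f, u, hfc, hf⟩ :=
    geometric_hahn_banach_point_closed hconv (isClosed_mulVec_orthant M) hc
  set y : κ → ℝ := fun i => f (Pi.single i 1) with hy
  have hfy : ∀ x : κ → ℝ, f x = x ⬝ᵥ y := fun x => by
    conv_lhs => rw [pi_eq_sum_univ' x]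
    simp [map_sum, dotProduct, hy, smul_eq_mul]
  have hu : u < 0 := by
    have := hf 0 ⟨0, le_rfl, by simp⟩
    simpa using this
  have hnn : 0 ≤ Mᵀ *ᵥ y := by
    intro i
    by_contra! hlt
    rw [Pi.zero_apply] at hlt
    have h1 : ∀ t : ℝ, 0 ≤ t → u < t * (Mᵀ *ᵥ y) i := by
      intro t ht
      have := hf (M *ᵥ Pi.single i t) ⟨_, Pi.single_nonneg.2 ht, rfl⟩
      rwa [hfy, dotProduct_comm, Matrix.dotProduct_mulVec, dotProduct_single,
        ← Matrix.mulVec_transpose, mul_comm] at this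
    have h2 := h1 (u / (Mᵀ *ᵥ y) i) (div_nonneg_of_nonpos hu.le hlt.le)
    rw [div_mul_cancel₀ _ hlt.ne] at h2
    exact lt_irrefl _ h2
  have := h y hnn
  rw [← hfy] at this
  linarith

/-- The Karush–Kuhn–Tucker conditions at a minimizer of a quadratic program. -/
theorem exists_multiplier {Q : Matrix ι ι ℝ} (hQ : Q.IsSymm) {q : ι → ℝ} {D : Matrix κ ι ℝ}
    {b : κ → ℝ} {z : ι → ℝ} (hz : b ≤ D *ᵥ z) (hmin : ∀ y, b ≤ D *ᵥ y →
      q ⬝ᵥ z + 1 / 2 * (z ⬝ᵥ (Q *ᵥ z)) ≤ q ⬝ᵥ y + 1 / 2 * (y ⬝ᵥ (Q *ᵥ y))) :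
    ∃ η : κ → ℝ, 0 ≤ η ∧ Dᵀ *ᵥ η = q + Q *ᵥ z ∧ ∀ i, (D *ᵥ z) i ≠ b i → η i = 0 := by
  classical
  -- Columns of inactive constraints are zeroed, so the Farkas test directions are those along which
  -- no active constraint decreases to first order.
  set M : Matrix ι κ ℝ := Matrix.of fun j i => if (D *ᵥ z) i = b i then D i j else 0 with hM
  have hM1 : ∀ y i, (D *ᵥ z) i = b i → (Mᵀ *ᵥ y) i = (D *ᵥ y) i := fun y i hi => by
    simp only [Matrix.mulVec, dotProduct] at hi
    simp [Matrix.mulVec, dotProduct, hM, hi]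
  obtain ⟨w, hw, hMw⟩ := farkas M (q + Q *ᵥ z) (by
    intro y hy
    have hfeas : ∀ᶠ t : ℝ in 𝓝[>] 0, ∀ i, b i ≤ (D *ᵥ (z + t • y)) i := by
      rw [eventually_all]
      intro i
      simp only [Matrix.mulVec_add, Matrix.mulVec_smul, Pi.add_apply, Pi.smul_apply, smul_eq_mul]
      rcases (hz i).eq_or_lt with h | h
      · filter_upwards [self_mem_nhdsWithin] with t ht
        have h0 := hy i
        rw [hM1 y i h.symm] at h0
        rw [h]
        exact le_add_of_nonneg_right (mul_nonneg (le_of_lt ht) h0)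
      · have hc : ContinuousAt (fun t : ℝ => (D *ᵥ z) i + t * (D *ᵥ y) i) 0 := by fun_prop
        have := Tendsto.eventually_const_lt (u := b i) (by simpa using h) hc
        exact (this.filter_mono nhdsWithin_le_nhds).mono fun t ht => ht.le
    have hc : ContinuousAt
        (fun t : ℝ => (q + Q *ᵥ z) ⬝ᵥ y + 1 / 2 * t * (y ⬝ᵥ (Q *ᵥ y))) 0 := by fun_prop
    have hlim := Tendsto.mono_left hc (nhdsWithin_le_nhds (s := Ioi 0))
    simp only [mul_zero, zero_mul, add_zero] at hlim
    refine ge_of_tendsto hlim ?_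
    filter_upwards [hfeas, self_mem_nhdsWithin] with t ht ht0
    have h := hmin _ ht
    rw [objective_add_smul hQ] at h
    have ht0' : 0 < t := ht0
    have h2 : 0 ≤ t * ((q + Q *ᵥ z) ⬝ᵥ y + 1 / 2 * t * (y ⬝ᵥ (Q *ᵥ y))) := by nlinarith
    exact (mul_nonneg_iff_of_pos_left ht0').1 h2)
  refine ⟨fun i => if (D *ᵥ z) i = b i then w i else 0, fun i => ?_, ?_, fun i hi => by simp [hi]⟩
  · dsimp only
    split_ifs
    exacts [hw i, le_rfl]
  · rw [← hMw]
    ext j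
    simp only [Matrix.mulVec, dotProduct, hM, Matrix.transpose_apply, Matrix.of_apply]
    exact Finset.sum_congr rfl fun i _ => by split_ifs <;> simp

/-- Weak form of linear programming duality with an attained dual. -/
theorem exists_dual_solution {D : Matrix κ ι ℝ} {b : κ → ℝ} {c : ι → ℝ} {β : ℝ}
    (hne : ∃ z, b ≤ D *ᵥ z) (hβ : ∀ z, b ≤ D *ᵥ z → β ≤ c ⬝ᵥ z) :
    ∃ μ : κ → ℝ, (0 ≤ μ ∧ Dᵀ *ᵥ μ = c) ∧ β ≤ b ⬝ᵥ μ := by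
  have hQ : (0 : Matrix ι ι ℝ).IsSymm := Matrix.isSymm_zero
  obtain ⟨z, hz, hmin⟩ := exists_isMin_of_bounded hQ c D b hne (β := β) (by simpa using hβ)
  obtain ⟨μ, hμ, hDμ, hsupp⟩ := exists_multiplier hQ hz hmin
  simp only [Matrix.zero_mulVec, add_zero] at hDμ
  refine ⟨μ, ⟨hμ, hDμ⟩, ?_⟩
  have : b ⬝ᵥ μ = c ⬝ᵥ z := by
    rw [← hDμ, Matrix.mulVec_transpose, ← Matrix.dotProduct_mulVec, dotProduct_comm]
    refine Finset.sum_congr rfl fun i _ => ?_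
    by_cases h : (D *ᵥ z) i = b i
    · rw [h]
    · simp [hsupp i h]
  rw [this]
  exact hβ z hz

/-- Moving along a kernel direction that is zero off the support, one loses a support element. -/
theorem exists_smaller_support {μ d : κ → ℝ} (hμ : 0 ≤ μ) (hd : ∀ i, μ i = 0 → d i = 0)
    (hneg : ∃ i, d i < 0) :
    ∃ t : ℝ, 0 ≤ t ∧ 0 ≤ μ + t • d ∧
      (Finset.univ.filter fun i => (μ + t • d) i ≠ 0).card <
        (Finset.univ.filter fun i => μ i ≠ 0).card := by
  classical
  -- Ratio test: `i₀` is the first coordinate to reach zero along `d`.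
  obtain ⟨i₀, hi₀, hmin⟩ := Finset.exists_min_image (Finset.univ.filter fun i => d i < 0)
    (fun i => μ i / -d i) (by simpa [Finset.filter_nonempty_iff] using hneg)
  simp only [Finset.mem_filter, Finset.mem_univ, true_and] at hi₀ hmin
  have ht : 0 ≤ μ i₀ / -d i₀ := div_nonneg (hμ i₀) (by linarith)
  refine ⟨μ i₀ / -d i₀, ht, fun i => ?_, Finset.card_lt_card ?_⟩
  · simp only [Pi.zero_apply, Pi.add_apply, Pi.smul_apply, smul_eq_mul]
    rcases lt_or_ge (d i) 0 with h | h
    · have := (le_div_iff₀ (by linarith : 0 < -d i)).1 (hmin i h)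
      linarith
    · exact add_nonneg (hμ i) (mul_nonneg ht h)
  · rw [Finset.ssubset_iff_of_subset]
    · refine ⟨i₀, ?_, ?_⟩
      · simp only [Finset.mem_filter, Finset.mem_univ, true_and]
        exact fun h => hi₀.ne (hd i₀ h)
      · simp only [Finset.mem_filter, Finset.mem_univ, true_and, Pi.add_apply, Pi.smul_apply,
          smul_eq_mul, not_not]
        rw [div_neg, neg_mul, div_mul_cancel₀ _ hi₀.ne]
        ring
    · intro i
      simp only [Finset.mem_filter, Finset.mem_univ, true_and, Pi.add_apply, Pi.smul_apply,
        smul_eq_mul]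
      intro h h0
      exact h (by rw [h0, hd i h0]; ring)

/-- If the primal program is feasible, then every dual value is matched at a dual vertex. -/
theorem exists_dual_vertex {D : Matrix κ ι ℝ} {b : κ → ℝ} {c : ι → ℝ} {β : ℝ}
    (hne : ∃ z, b ≤ D *ᵥ z) (hμ : ∃ μ : κ → ℝ, (0 ≤ μ ∧ Dᵀ *ᵥ μ = c) ∧ β ≤ b ⬝ᵥ μ) :
    ∃ μ ∈ extremePoints ℝ {μ : κ → ℝ | 0 ≤ μ ∧ Dᵀ *ᵥ μ = c}, β ≤ b ⬝ᵥ μ := by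
  classical
  -- A candidate of minimal support is a vertex.
  obtain ⟨μ, ⟨hμ, hβ⟩, hmin⟩ := (measure fun μ : κ → ℝ =>
    (Finset.univ.filter fun i => μ i ≠ 0).card).wf.has_min
      {μ : κ → ℝ | (0 ≤ μ ∧ Dᵀ *ᵥ μ = c) ∧ β ≤ b ⬝ᵥ μ} hμ
  have hred : ∀ d : κ → ℝ, Dᵀ *ᵥ d = 0 → (∀ i, μ i = 0 → d i = 0) → 0 ≤ b ⬝ᵥ d →
      ¬ ∃ i, d i < 0 := by
    intro d hd hsupp hbd hneg
    obtain ⟨t, ht, hnn, hcard⟩ := exists_smaller_support hμ.1 hsupp hneg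
    refine hmin (μ + t • d) ⟨⟨hnn, ?_⟩, ?_⟩ hcard
    · rw [Matrix.mulVec_add, Matrix.mulVec_smul, hd, hμ.2, smul_zero, add_zero]
    · rw [dotProduct_add, dotProduct_smul, smul_eq_mul]
      have := mul_nonneg ht hbd
      linarith
  -- Minimality forces `0 ≤ d`; pairing with a feasible `z` then gives `b ⬝ᵥ d ≤ 0`, so the same
  -- argument applies to `-d`.
  have hzero : ∀ d : κ → ℝ, Dᵀ *ᵥ d = 0 → (∀ i, μ i = 0 → d i = 0) → 0 ≤ b ⬝ᵥ d → d = 0 := by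
    intro d hd hsupp hbd
    have h1 := hred d hd hsupp hbd
    push Not at h1
    obtain ⟨z, hz⟩ := hne
    have h2 : b ⬝ᵥ d ≤ 0 := by
      calc b ⬝ᵥ d ≤ (D *ᵥ z) ⬝ᵥ d :=
            Finset.sum_le_sum fun i _ => mul_le_mul_of_nonneg_right (hz i) (h1 i)
        _ = 0 := by
            rw [dotProduct_comm, Matrix.dotProduct_mulVec, ← Matrix.mulVec_transpose, hd,
              zero_dotProduct]
    have h3 := hred (-d) (by rw [Matrix.mulVec_neg, hd, neg_zero])
      (fun i hi => by simp [hsupp i hi]) (by rw [dotProduct_neg]; linarith)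
    push Not at h3
    ext i
    have := h3 i
    rw [Pi.neg_apply] at this
    exact le_antisymm (neg_nonneg.1 this) (h1 i)
  refine ⟨μ, mem_extremePoints.2 ⟨hμ, fun x hx y hy hxy => ?_⟩, hβ⟩
  obtain ⟨s, t, hs, ht, hst, he⟩ := hxy
  have hsupp : ∀ i, μ i = 0 → x i = 0 ∧ y i = 0 := by
    intro i hi
    have h := congrFun he i
    simp only [Pi.add_apply, Pi.smul_apply, smul_eq_mul, hi] at h
    have hxi := hx.1 i
    have hyi := hy.1 i
    simp only [Pi.zero_apply] at hxi hyi
    constructor <;> nlinarith [mul_nonneg hs.le hxi, mul_nonneg ht.le hyi]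
  have hD : Dᵀ *ᵥ (x - y) = 0 := by rw [Matrix.mulVec_sub, hx.2, hy.2, sub_self]
  have heq : x = y := by
    rcases le_total 0 (b ⬝ᵥ (x - y)) with h | h
    · exact sub_eq_zero.1 (hzero _ hD (fun i hi => by simp [hsupp i hi]) h)
    · refine (sub_eq_zero.1 (hzero (y - x) ?_ (fun i hi => by simp [hsupp i hi]) ?_)).symm
      · rw [← neg_sub, Matrix.mulVec_neg, hD, neg_zero]
      · rw [← neg_sub, dotProduct_neg]; linarith
  subst heq
  have : x = μ := by rw [← he, ← add_smul, hst, one_smul]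
  exact ⟨this, this⟩

end Cones

/-! ### Minimizers and the domain of finiteness -/

section Domain

variable {m k : ℕ} {Q : Matrix (Fin m) (Fin m) ℝ} {D : Matrix (Fin k) (Fin m) ℝ}
  {x : (Fin m → ℝ) × (Fin k → ℝ)}

theorem optVal_eq_of_isMin {z : Fin m → ℝ} (hz : z ∈ feasible D x.2)
    (hmin : ∀ y ∈ feasible D x.2, objective Q x.1 z ≤ objective Q x.1 y) :
    optVal Q D x = objective Q x.1 z :=
  le_antisymm (iInf₂_le z hz) (le_iInf₂ fun y hy => EReal.coe_le_coe_iff.2 (hmin y hy))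

theorem qpOpt_eq_of_isMin {z : Fin m → ℝ} (hz : z ∈ feasible D x.2)
    (hmin : ∀ y ∈ feasible D x.2, objective Q x.1 z ≤ objective Q x.1 y) :
    qpOpt Q D x = objective Q x.1 z := by
  rw [qpOpt, optVal_eq_of_isMin hz hmin, EReal.toReal_coe]

theorem feasible_nonempty_of_mem_dom (hx : x ∈ dom Q D) : (feasible D x.2).Nonempty := by
  by_contra h
  rw [not_nonempty_iff_eq_empty] at h
  have := hx.2
  simp [optVal, h] at this

theorem exists_lower_bound_of_mem_dom (hx : x ∈ dom Q D) :
    ∃ β : ℝ, ∀ z ∈ feasible D x.2, β ≤ objective Q x.1 z := by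
  obtain ⟨β, -, hβ⟩ := EReal.lt_iff_exists_real_btwn.1 hx.1
  exact ⟨β, fun z hz => EReal.coe_le_coe_iff.1 (hβ.le.trans (iInf₂_le z hz))⟩

theorem mem_dom_of_bounded (hne : (feasible D x.2).Nonempty) {β : ℝ}
    (hβ : ∀ z ∈ feasible D x.2, β ≤ objective Q x.1 z) : x ∈ dom Q D := by
  obtain ⟨z, hz⟩ := hne
  exact ⟨(EReal.bot_lt_coe β).trans_le (le_iInf₂ fun z hz => EReal.coe_le_coe_iff.2 (hβ z hz)),
    (iInf₂_le z hz).trans_lt (EReal.coe_lt_top _)⟩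

theorem exists_kkt_of_mem_dom (hQ : Q.IsSymm) (hx : x ∈ dom Q D) :
    ∃ z ∈ feasible D x.2, ∃ η : Fin k → ℝ, 0 ≤ η ∧ Dᵀ *ᵥ η = x.1 + Q *ᵥ z ∧
      ∀ i, (D *ᵥ z) i ≠ x.2 i → η i = 0 := by
  obtain ⟨β, hβ⟩ := exists_lower_bound_of_mem_dom hx
  obtain ⟨z, hz, hmin⟩ :=
    exists_isMin_of_bounded hQ x.1 D x.2 (feasible_nonempty_of_mem_dom hx) hβ
  exact ⟨z, hz, exists_multiplier hQ hz hmin⟩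

theorem exists_mem_kktCone (hQ : Q.IsSymm) (hx : x ∈ dom Q D) : ∃ I, x ∈ kktCone Q D I := by
  classical
  obtain ⟨z, hz, η, hη, heq, hsupp⟩ := exists_kkt_of_mem_dom hQ hx
  refine ⟨Finset.univ.filter fun i => (D *ᵥ z) i = x.2 i, z, η, ?_, fun i hi => ?_, fun i hi => ?_⟩
  · rw [heq, sub_self]
  · exact ⟨by simpa using hi, hη i⟩
  · exact ⟨hz i, hsupp i (by simpa using hi)⟩

/-! ### Closedness of the pieces -/

/-- The cone is a linear image of an orthant: `z` is split into positive and negative parts, and one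
nonnegative coordinate per constraint serves as `η i` for `i ∈ I` and as the slack for `i ∉ I`. -/
theorem isClosed_kktCone (Q : Matrix (Fin m) (Fin m) ℝ) (D : Matrix (Fin k) (Fin m) ℝ)
    (I : Finset (Fin k)) : IsClosed (kktCone Q D I) := by
  classical
  let Z : (Fin m ⊕ Fin m ⊕ Fin k → ℝ) →ₗ[ℝ] (Fin m → ℝ) :=
    LinearMap.funLeft ℝ ℝ Sum.inl - LinearMap.funLeft ℝ ℝ (Sum.inr ∘ Sum.inl)
  let U : (Fin m ⊕ Fin m ⊕ Fin k → ℝ) →ₗ[ℝ] (Fin k → ℝ) := LinearMap.funLeft ℝ ℝ (Sum.inr ∘ Sum.inr)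
  let H := (Matrix.diagonal fun i => if i ∈ I then (1 : ℝ) else 0).mulVecLin ∘ₗ U
  let S := (Matrix.diagonal fun i => if i ∈ I then (0 : ℝ) else 1).mulVecLin ∘ₗ U
  let T := (Dᵀ.mulVecLin ∘ₗ H - Q.mulVecLin ∘ₗ Z).prod (D.mulVecLin ∘ₗ Z - S)
  have hT : ∀ w, T w = (Dᵀ *ᵥ H w - Q *ᵥ Z w, D *ᵥ Z w - S w) := fun w => rfl
  have hH : ∀ w i, H w i = if i ∈ I then w (Sum.inr (Sum.inr i)) else 0 := fun w i => by
    simp [H, U, Matrix.mulVec_diagonal, LinearMap.funLeft]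
  have hS : ∀ w i, S w i = if i ∈ I then 0 else w (Sum.inr (Sum.inr i)) := fun w i => by
    simp [S, U, Matrix.mulVec_diagonal, LinearMap.funLeft]
  have hZ : ∀ w j, Z w j = w (Sum.inl j) - w (Sum.inr (Sum.inl j)) := fun w j => by
    simp [Z, LinearMap.funLeft]
  convert isClosed_image_orthant T using 1
  ext ⟨q, b⟩
  simp only [kktCone, mem_ofPred_eq, hT, Prod.mk.injEq]
  constructor
  · rintro ⟨z, η, h1, h2, h3⟩
    set w : Fin m ⊕ Fin m ⊕ Fin k → ℝ := Sum.elim (fun j => (z j)⁺) (Sum.elim (fun j => (z j)⁻)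
      fun i => if i ∈ I then η i else (D *ᵥ z) i - b i) with hw
    have hZw : Z w = z := by
      ext j
      rw [hZ]
      exact posPart_sub_negPart (z j)
    have hHw : H w = η := by
      ext i
      rw [hH]
      by_cases hi : i ∈ I
      · simp [hw, hi]
      · simp [hi, (h3 i hi).2]
    have hSw : S w = D *ᵥ z - b := by
      ext i
      rw [hS]
      by_cases hi : i ∈ I
      · simp [hi, (h2 i hi).1]
      · simp [hw, hi]
    refine ⟨w, ?_, ?_, ?_⟩
    · rintro (j | j | i)
      · exact posPart_nonneg _
      · exact negPart_nonneg _
      · simp only [hw, Sum.elim_inr, Pi.zero_apply]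
        by_cases hi : i ∈ I
        · simp [hi, (h2 i hi).2]
        · simp [hi, (h3 i hi).1]
    · rw [hZw, hHw, ← sub_eq_zero, ← neg_eq_zero, ← h1]
      abel
    · rw [hZw, hSw, sub_sub_cancel]
  · rintro ⟨w, hw, rfl, rfl⟩
    refine ⟨Z w, H w, by abel, fun i hi => ?_, fun i hi => ?_⟩
    · simp only [Pi.sub_apply, hS, hH, hi, if_true, sub_zero, true_and]
      exact hw _
    · simp only [Pi.sub_apply, hS, hH, hi, if_false, and_true]
      exact sub_le_self _ (hw _)

theorem isClosed_feasible_nonempty (D : Matrix (Fin k) (Fin m) ℝ) :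
    IsClosed {b : Fin k → ℝ | (feasible D b).Nonempty} := by
  have hc : Continuous fun b : Fin k → ℝ => ((0, b) : (Fin m → ℝ) × (Fin k → ℝ)) := by fun_prop
  convert (isClosed_kktCone 0 D ∅).preimage hc using 1
  ext b
  simp only [Set.Nonempty, feasible, mem_ofPred_eq, kktCone, mem_preimage, Matrix.zero_mulVec]
  constructor
  · rintro ⟨z, hz⟩
    exact ⟨z, 0, by simp, by simp, fun i _ => ⟨hz i, rfl⟩⟩
  · rintro ⟨z, η, -, -, h⟩
    exact ⟨z, fun i => (h i (Finset.notMem_empty i)).1⟩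

variable {L : Finset (Fin k) → ℕ}
  {gen : (I : Finset (Fin k)) → Fin (L I) → (Fin m → ℝ) × (Fin k → ℝ)}

theorem isClosed_domPiece (D : Matrix (Fin k) (Fin m) ℝ)
    (mu : (I : Finset (Fin k)) → Fin (L I) → (Fin k → ℝ)) :
    IsClosed (domPiece D L gen mu) := by
  have h1 := (isClosed_feasible_nonempty D).preimage
    (continuous_snd (X := Fin m → ℝ) (Y := Fin k → ℝ))
  have h2 : IsClosed {x : (Fin m → ℝ) × (Fin k → ℝ) |
      ∀ I l, 0 ≤ x.1 ⬝ᵥ (gen I l).1 + x.2 ⬝ᵥ mu I l} := by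
    simp only [ofPred_forall]
    refine isClosed_iInter fun I => isClosed_iInter fun l => isClosed_le continuous_const ?_
    exact (continuous_dotProduct continuous_fst continuous_const).add
      (continuous_dotProduct continuous_snd continuous_const)
  exact h1.inter h2

theorem isClosed_of_mem_pieceFamily {S : Set ((Fin m → ℝ) × (Fin k → ℝ))}
    (hS : S ∈ pieceFamily Q D L gen) : IsClosed S := by
  obtain ⟨mu, I, -, rfl⟩ := hS
  exact (isClosed_domPiece D mu).inter (isClosed_kktCone Q D I)

theorem finite_pieceFamily (Q : Matrix (Fin m) (Fin m) ℝ) (D : Matrix (Fin k) (Fin m) ℝ)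
    (gen : (I : Finset (Fin k)) → Fin (L I) → (Fin m → ℝ) × (Fin k → ℝ)) :
    (pieceFamily Q D L gen).Finite := by
  have h : (univ.pi fun I : Finset (Fin k) => univ.pi fun l : Fin (L I) =>
      dualVertices Q D (gen I l).1).Finite :=
    Set.Finite.pi fun I => Set.Finite.pi fun l => finite_extremePoints_standard _ _
  refine ((h.prod (finite_univ (α := Finset (Fin k)))).image
    fun y => domPiece D L gen y.1 ∩ kktCone Q D y.2).subset ?_
  rintro S ⟨mu, I, hmu, rfl⟩
  exact ⟨(mu, I), ⟨fun J _ l _ => hmu J l, mem_univ _⟩, rfl⟩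

/-! ### The pieces cover the domain -/

/-- For finite optimal value, a generator of a KKT recession cone is compensated by some vertex of
the associated dual polyhedron. -/
theorem exists_compensating_vertex (hQ : Q.IsSymm) (hx : x ∈ dom Q D) {I : Finset (Fin k)}
    {y : (Fin m → ℝ) × (Fin k → ℝ)} (hy : y ∈ kktRecCone Q D I) :
    ∃ μ ∈ dualVertices Q D y.1, 0 ≤ x.1 ⬝ᵥ y.1 + x.2 ⬝ᵥ μ := by
  obtain ⟨h1, h2, h3⟩ := hy
  have hne := feasible_nonempty_of_mem_dom hx
  obtain ⟨β, hβ⟩ := exists_lower_bound_of_mem_dom hx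
  have hv : 0 ≤ D *ᵥ y.1 := fun i => by
    by_cases hi : i ∈ I
    · exact (h2 i hi).1.ge
    · exact (h3 i hi).1
  have hcurv : y.1 ⬝ᵥ (Q *ᵥ y.1) = 0 := by
    rw [sub_eq_zero.1 h1, Matrix.dotProduct_mulVec, Matrix.vecMul_transpose]
    refine Finset.sum_eq_zero fun i _ => ?_
    by_cases hi : i ∈ I
    · rw [(h2 i hi).1, zero_mul]
    · rw [(h3 i hi).2, mul_zero]
  -- The nonnegative slope along `y.1`, read as a lower bound for a linear program in `z` whose dual
  -- polyhedron is the one defining `dualVertices`.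
  have hbound : ∀ z, x.2 ≤ D *ᵥ z → -(x.1 ⬝ᵥ y.1) ≤ (Q *ᵥ y.1) ⬝ᵥ z := fun z hz => by
    have h := slope_nonneg_of_bounded hQ hβ hv hcurv.le hz
    have h' : (Q *ᵥ z) ⬝ᵥ y.1 = (Q *ᵥ y.1) ⬝ᵥ z := by
      rw [dotProduct_comm, Matrix.dotProduct_mulVec, ← Matrix.mulVec_transpose, hQ.eq]
    rw [add_dotProduct, h'] at h
    linarith
  obtain ⟨μ, hμ, hle⟩ := exists_dual_vertex hne (exists_dual_solution hne hbound)
  exact ⟨μ, hμ, by linarith⟩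

theorem dom_subset_sUnion_pieceFamily (hQ : Q.IsSymm) (hgen : IsGeneratorSystem Q D L gen) :
    dom Q D ⊆ ⋃₀ pieceFamily Q D L gen := by
  classical
  intro x hx
  have hmem : ∀ I l, gen I l ∈ kktRecCone Q D I := fun I l => by
    rw [hgen I]
    exact ⟨Pi.single l 1, fun j => (Pi.single_nonneg.2 zero_le_one : (0 : Fin (L I) → ℝ) ≤ _) j, by
      simp [Pi.single_apply]⟩
  choose mu hmu hpos using fun I l => exists_compensating_vertex hQ hx (hmem I l)
  obtain ⟨I, hI⟩ := exists_mem_kktCone hQ hx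
  exact ⟨_, ⟨mu, I, hmu, rfl⟩, ⟨feasible_nonempty_of_mem_dom hx, hpos⟩, hI⟩

/-! ### The convex case -/

/-- Expanding at `z` leaves a linear term that is nonnegative by complementarity and a nonnegative
curvature term. -/
theorem isMin_of_kkt (hQ : Q.IsSymm) (hpos : Q.PosSemidef) {I : Finset (Fin k)} {z : Fin m → ℝ}
    {η : Fin k → ℝ} (h1 : x.1 + Q *ᵥ z - Dᵀ *ᵥ η = 0)
    (h2 : ∀ i ∈ I, (D *ᵥ z) i = x.2 i ∧ 0 ≤ η i)
    (h3 : ∀ i, i ∉ I → x.2 i ≤ (D *ᵥ z) i ∧ η i = 0) :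
    z ∈ feasible D x.2 ∧ ∀ y ∈ feasible D x.2, objective Q x.1 z ≤ objective Q x.1 y := by
  refine ⟨fun i => ?_, fun y hy => ?_⟩
  · by_cases hi : i ∈ I
    · exact (h2 i hi).1.ge
    · exact (h3 i hi).1
  · have h := objective_add_smul hQ x.1 z (y - z) 1
    rw [one_smul, add_sub_cancel, sub_eq_zero.1 h1] at h
    have hq : 0 ≤ (y - z) ⬝ᵥ (Q *ᵥ (y - z)) := by
      simpa using hpos.dotProduct_mulVec_nonneg (y - z)
    have hs : 0 ≤ (Dᵀ *ᵥ η) ⬝ᵥ (y - z) := by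
      rw [Matrix.mulVec_transpose, ← Matrix.dotProduct_mulVec, Matrix.mulVec_sub]
      refine Finset.sum_nonneg fun i _ => ?_
      by_cases hi : i ∈ I
      · refine mul_nonneg (h2 i hi).2 ?_
        rw [Pi.sub_apply, (h2 i hi).1, sub_nonneg]
        exact hy i
      · rw [(h3 i hi).2, zero_mul]
    simp only [objective]
    linarith

/-- By convexity, the tangent at any dual-feasible `(z, η)` bounds the objective below on the
feasible set, even when `z` itself is infeasible. Both conditions on the right pass to convex
combinations. -/
theorem mem_dom_iff_of_posSemidef (hQ : Q.IsSymm) (hpos : Q.PosSemidef) :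
    x ∈ dom Q D ↔ (∃ z, x.2 ≤ D *ᵥ z) ∧
      ∃ (z : Fin m → ℝ) (η : Fin k → ℝ), 0 ≤ η ∧ Dᵀ *ᵥ η = x.1 + Q *ᵥ z := by
  refine ⟨fun hx => ?_, ?_⟩
  · obtain ⟨z, hz, η, hη, heq, -⟩ := exists_kkt_of_mem_dom hQ hx
    exact ⟨⟨z, hz⟩, z, η, hη, heq⟩
  · rintro ⟨hne, z, η, hη, heq⟩
    refine mem_dom_of_bounded hne (β := objective Q x.1 z + (η ⬝ᵥ x.2 - η ⬝ᵥ (D *ᵥ z)))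
      fun y hy => ?_
    have h := objective_add_smul hQ x.1 z (y - z) 1
    rw [one_smul, add_sub_cancel, ← heq, Matrix.mulVec_transpose, ← Matrix.dotProduct_mulVec,
      Matrix.mulVec_sub, dotProduct_sub] at h
    have hq : 0 ≤ (y - z) ⬝ᵥ (Q *ᵥ (y - z)) := by
      simpa using hpos.dotProduct_mulVec_nonneg (y - z)
    have hs : η ⬝ᵥ x.2 ≤ η ⬝ᵥ (D *ᵥ y) :=
      Finset.sum_le_sum fun i _ => mul_le_mul_of_nonneg_left (hy i) (hη i)
    simp only [objective]
    linarith

theorem convex_dom_of_posSemidef (hQ : Q.IsSymm) (hpos : Q.PosSemidef) :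
    Convex ℝ (dom Q D) := by
  intro x hx y hy a b ha hb _
  rw [mem_dom_iff_of_posSemidef hQ hpos] at hx hy ⊢
  obtain ⟨⟨z, hz⟩, u, η, hη, hx⟩ := hx
  obtain ⟨⟨z', hz'⟩, u', η', hη', hy⟩ := hy
  refine ⟨⟨a • z + b • z', ?_⟩, a • u + b • u', a • η + b • η',
    add_nonneg (smul_nonneg ha hη) (smul_nonneg hb hη'), ?_⟩
  · rw [Matrix.mulVec_add, Matrix.mulVec_smul, Matrix.mulVec_smul]
    exact add_le_add (smul_le_smul_of_nonneg_left hz ha) (smul_le_smul_of_nonneg_left hz' hb)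
  · simp only [Matrix.mulVec_add, Matrix.mulVec_smul, hx, hy, Prod.fst_add, Prod.smul_fst,
      smul_add]
    abel

/-- The equality part of the KKT system with active set `I`, as a linear relation between the data
`(q, b)` and the primal-dual pair `(z, η)`. -/
def kktRelation (Q : Matrix (Fin m) (Fin m) ℝ) (D : Matrix (Fin k) (Fin m) ℝ)
    (I : Finset (Fin k)) :
    Submodule ℝ (((Fin m → ℝ) × (Fin k → ℝ)) × ((Fin m → ℝ) × (Fin k → ℝ))) where
  carrier := {r | r.1.1 + Q *ᵥ r.2.1 - Dᵀ *ᵥ r.2.2 = 0 ∧ (∀ i ∈ I, (D *ᵥ r.2.1) i = r.1.2 i) ∧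
    ∀ i, i ∉ I → r.2.2 i = 0}
  zero_mem' := by simp
  add_mem' := by
    rintro r s ⟨h1, h2, h3⟩ ⟨h1', h2', h3'⟩
    refine ⟨?_, fun i hi => ?_, fun i hi => ?_⟩
    · rw [← add_zero (0 : Fin m → ℝ)]
      nth_rewrite 1 [← h1]
      rw [← h1']
      simp only [Prod.fst_add, Prod.snd_add, Matrix.mulVec_add]
      abel
    · simp [Matrix.mulVec_add, h2 i hi, h2' i hi]
    · simp [h3 i hi, h3' i hi]
  smul_mem' := by
    rintro c r ⟨h1, h2, h3⟩
    refine ⟨?_, fun i hi => ?_, fun i hi => ?_⟩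
    · rw [← smul_zero c, ← h1]
      simp only [Prod.smul_fst, Prod.smul_snd, Matrix.mulVec_smul, smul_sub, smul_add]
    · simp [Matrix.mulVec_smul, h2 i hi]
    · simp [h3 i hi]

/-- Symmetry of `Q` and complementarity cancel the difference of two solutions, so the pairing
depends on the data alone. -/
theorem kktRelation_pairing_eq (hQ : Q.IsSymm) {I : Finset (Fin k)}
    {y y' : (Fin m → ℝ) × (Fin k → ℝ)} (h : (x, y) ∈ kktRelation Q D I)
    (h' : (x, y') ∈ kktRelation Q D I) :
    x.1 ⬝ᵥ y.1 + x.2 ⬝ᵥ y.2 = x.1 ⬝ᵥ y'.1 + x.2 ⬝ᵥ y'.2 := by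
  obtain ⟨h1, h2, h3⟩ := h
  obtain ⟨h1', h2', h3'⟩ := h'
  simp only at h1 h2 h3 h1' h2' h3'
  have hx : x.1 = Dᵀ *ᵥ y.2 - Q *ᵥ y.1 := by rw [← sub_eq_zero, ← h1]; abel
  have hv : Q *ᵥ (y.1 - y'.1) = Dᵀ *ᵥ (y.2 - y'.2) := by
    rw [Matrix.mulVec_sub, Matrix.mulVec_sub, ← sub_eq_zero, ← sub_zero (0 : Fin m → ℝ)]
    nth_rewrite 1 [← h1]
    rw [← h1']
    abel
  have e1 : (Dᵀ *ᵥ y.2) ⬝ᵥ (y.1 - y'.1) = 0 := by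
    rw [Matrix.mulVec_transpose, ← Matrix.dotProduct_mulVec, Matrix.mulVec_sub]
    refine Finset.sum_eq_zero fun i _ => ?_
    by_cases hi : i ∈ I
    · rw [Pi.sub_apply, h2 i hi, h2' i hi, sub_self, mul_zero]
    · rw [h3 i hi, zero_mul]
  have e2 : (Q *ᵥ y.1) ⬝ᵥ (y.1 - y'.1) = x.2 ⬝ᵥ (y.2 - y'.2) := by
    rw [← Matrix.vecMul_transpose, hQ.eq, ← Matrix.dotProduct_mulVec, hv,
      Matrix.dotProduct_mulVec, Matrix.vecMul_transpose]
    refine Finset.sum_congr rfl fun i _ => ?_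
    by_cases hi : i ∈ I
    · rw [h2 i hi]
    · simp [h3 i hi, h3' i hi]
  have e3 : x.1 ⬝ᵥ (y.1 - y'.1) = -(x.2 ⬝ᵥ (y.2 - y'.2)) := by
    rw [← e2]
    nth_rewrite 1 [hx]
    rw [sub_dotProduct, e1, zero_sub]
  rw [dotProduct_sub, dotProduct_sub] at e3
  linarith

/-- Pairing stationarity with `y.1` eliminates the quadratic term, leaving an expression bilinear in
the data and the solution. -/
theorem objective_eq_of_mem_kktRelation {I : Finset (Fin k)}
    {y : (Fin m → ℝ) × (Fin k → ℝ)} (h : (x, y) ∈ kktRelation Q D I) :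
    objective Q x.1 y.1 = 1 / 2 * (x.1 ⬝ᵥ y.1 + x.2 ⬝ᵥ y.2) := by
  obtain ⟨h1, h2, h3⟩ := h
  simp only at h1 h2 h3
  have e : (x.1 + Q *ᵥ y.1) ⬝ᵥ y.1 = x.2 ⬝ᵥ y.2 := by
    rw [sub_eq_zero.1 h1, Matrix.mulVec_transpose, ← Matrix.dotProduct_mulVec, dotProduct_comm]
    refine Finset.sum_congr rfl fun i _ => ?_
    by_cases hi : i ∈ I
    · rw [h2 i hi]
    · simp [h3 i hi]
  rw [add_dotProduct, dotProduct_comm (Q *ᵥ y.1)] at e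
  rw [objective]
  linarith

/-- The value at KKT points with a fixed active set is a quadratic function of the data. -/
theorem exists_quadratic_value (hQ : Q.IsSymm) (D : Matrix (Fin k) (Fin m) ℝ)
    (I : Finset (Fin k)) :
    ∃ p : (Fin m → ℝ) × (Fin k → ℝ) → ℝ, IsQuadraticFunction p ∧
      ∀ x y, (x, y) ∈ kktRelation Q D I → objective Q x.1 y.1 = p x := by
  let π : kktRelation Q D I →ₗ[ℝ] (Fin m → ℝ) × (Fin k → ℝ) :=
    LinearMap.fst ℝ _ _ ∘ₗ (kktRelation Q D I).subtype
  -- A linear choice of solution on the solvable data, extended to the whole space; inserting it in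
  -- the bilinear pairing yields a quadratic form.
  obtain ⟨g, hg⟩ := LinearMap.exists_rightInverse_of_surjective π.rangeRestrict
    (LinearMap.range_rangeRestrict π)
  obtain ⟨S, hS⟩ := LinearMap.exists_extend g
  let T : (Fin m → ℝ) × (Fin k → ℝ) →ₗ[ℝ] (Fin m → ℝ) × (Fin k → ℝ) :=
    LinearMap.snd ℝ _ _ ∘ₗ (kktRelation Q D I).subtype ∘ₗ S
  have hT : ∀ x y, (x, y) ∈ kktRelation Q D I → (x, T x) ∈ kktRelation Q D I := by
    intro x y hxy
    have hx : x ∈ LinearMap.range π := ⟨⟨(x, y), hxy⟩, rfl⟩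
    have hSx : S x = g ⟨x, hx⟩ := LinearMap.congr_fun hS ⟨x, hx⟩
    have hgx : π (g ⟨x, hx⟩) = x := congrArg Subtype.val (LinearMap.congr_fun hg ⟨x, hx⟩)
    have h : ((S x : _ × _)) = (x, T x) := Prod.ext (by rw [hSx]; exact hgx) rfl
    rw [← h]
    exact (S x).2
  let B : LinearMap.BilinMap ℝ ((Fin m → ℝ) × (Fin k → ℝ)) ℝ :=
    LinearMap.mk₂ ℝ (fun x y => 1 / 2 * (x.1 ⬝ᵥ (T y).1 + x.2 ⬝ᵥ (T y).2))
      (fun x x' y => by simp only [Prod.fst_add, Prod.snd_add, add_dotProduct]; ring)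
      (fun c x y => by
        simp only [Prod.smul_fst, Prod.smul_snd, smul_dotProduct, smul_eq_mul]; ring)
      (fun x y y' => by simp only [map_add, Prod.fst_add, Prod.snd_add, dotProduct_add]; ring)
      (fun c x y => by
        simp only [map_smul, Prod.smul_fst, Prod.smul_snd, dotProduct_smul, smul_eq_mul]; ring)
  refine ⟨fun x => B x x, ⟨B.toQuadraticMap, 0, 0, fun x => by simp⟩, fun x y hxy => ?_⟩
  rw [objective_eq_of_mem_kktRelation hxy, kktRelation_pairing_eq hQ hxy (hT x y hxy)]
  rfl

theorem isDCOn_qpOpt_of_posSemidef (hQ : Q.IsSymm) (hpos : Q.PosSemidef)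
    (D : Matrix (Fin k) (Fin m) ℝ) : IsDCOn (dom Q D) (qpOpt Q D) := by
  refine isDCOn_of_finite_closed_cover (convex_dom_of_posSemidef hQ hpos)
    (finite_range (kktCone Q D)) ?_ ?_ ?_
  · rintro _ ⟨I, rfl⟩
    exact isClosed_kktCone Q D I
  · intro x hx
    obtain ⟨I, hI⟩ := exists_mem_kktCone hQ hx
    exact ⟨_, ⟨I, rfl⟩, hI⟩
  · rintro _ ⟨I, rfl⟩
    obtain ⟨p, hp, hval⟩ := exists_quadratic_value hQ D I
    refine ⟨p, hp, fun x hx => ?_⟩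
    obtain ⟨⟨z, η, h1, h2, h3⟩, -⟩ := hx
    obtain ⟨hz, hmin⟩ := isMin_of_kkt hQ hpos h1 h2 h3
    rw [qpOpt_eq_of_isMin hz hmin]
    exact hval x (z, η) ⟨h1, fun i hi => (h2 i hi).1, fun i hi => (h3 i hi).2⟩

end Domain

/-! ### Linear programs in standard form -/

section LinearProgram

variable {r n : ℕ}

/-- The constraint matrix of a standard-form linear program written with inequalities only. -/
def lpMatrix (A : Matrix (Fin r) (Fin n) ℝ) : Matrix (Fin (r + (r + n))) (Fin n) ℝ :=
  Matrix.of (Fin.append A (Fin.append (-A) (1 : Matrix (Fin n) (Fin n) ℝ)))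

/-- The data of the inequality form of a standard-form linear program. -/
def lpData (r n : ℕ) : (Fin r → ℝ) × (Fin n → ℝ) →ₗ[ℝ] (Fin n → ℝ) × (Fin (r + (r + n)) → ℝ) where
  toFun x := (x.2, Fin.append x.1 (Fin.append (-x.1) 0))
  map_add' x y := by
    refine Prod.ext rfl (funext fun i => ?_)
    refine Fin.addCases (fun i => ?_) (fun i => ?_) i
    · simp
    · refine Fin.addCases (fun i => ?_) (fun i => ?_) i
      · simp [add_comm]
      · simp
  map_smul' c x := by
    refine Prod.ext rfl (funext fun i => ?_)
    refine Fin.addCases (fun i => ?_) (fun i => ?_) i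
    · simp
    · refine Fin.addCases (fun i => ?_) (fun i => ?_) i <;> simp

theorem feasible_lpMatrix (A : Matrix (Fin r) (Fin n) ℝ) (x : (Fin r → ℝ) × (Fin n → ℝ)) :
    feasible (lpMatrix A) (lpData r n x).2 = {z | A *ᵥ z = x.1 ∧ 0 ≤ z} := by
  ext z
  have h1 : ∀ i, (lpMatrix A *ᵥ z) (Fin.castAdd _ i) = (A *ᵥ z) i := fun i => by
    have h : lpMatrix A (Fin.castAdd _ i) = A i := Fin.append_left _ _ i
    simp only [Matrix.mulVec, h]
  have h2 : ∀ i, (lpMatrix A *ᵥ z) (Fin.natAdd _ (Fin.castAdd _ i)) = -(A *ᵥ z) i := fun i => by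
    have h : lpMatrix A (Fin.natAdd _ (Fin.castAdd _ i)) = -A i :=
      (Fin.append_right _ _ _).trans (Fin.append_left _ _ i)
    simp only [Matrix.mulVec, h]
    exact neg_dotProduct _ _
  have h3 : ∀ i, (lpMatrix A *ᵥ z) (Fin.natAdd _ (Fin.natAdd _ i)) = z i := fun i => by
    have h : lpMatrix A (Fin.natAdd _ (Fin.natAdd _ i)) = (1 : Matrix (Fin n) (Fin n) ℝ) i :=
      (Fin.append_right _ _ _).trans (Fin.append_right _ _ i)
    have h' := congrFun (Matrix.one_mulVec z) i
    simp only [Matrix.mulVec, h] at h' ⊢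
    exact h'
  simp only [feasible, mem_ofPred_eq, Pi.le_def, Fin.forall_fin_add, h1, h2, h3, lpData,
    LinearMap.coe_mk, AddHom.coe_mk, Fin.append_left, Fin.append_right, Pi.neg_apply,
    Pi.zero_apply, neg_le_neg_iff, ← and_assoc, funext_iff]
  refine and_congr_left fun _ => ⟨fun h i => le_antisymm (h.2 i) (h.1 i), fun h => ?_⟩
  exact ⟨fun i => (h i).ge, fun i => (h i).le⟩

theorem lpVal_eq_optVal (A : Matrix (Fin r) (Fin n) ℝ) (x : (Fin r → ℝ) × (Fin n → ℝ)) :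
    lpVal A x = optVal 0 (lpMatrix A) (lpData r n x) := by
  rw [optVal, feasible_lpMatrix]
  simp only [lpVal, objective, Matrix.zero_mulVec, dotProduct_zero, mul_zero, add_zero]
  rfl

theorem isDCOn_lpOpt (A : Matrix (Fin r) (Fin n) ℝ) : IsDCOn (lpDom A) (lpOpt A) := by
  have h := (isDCOn_qpOpt_of_posSemidef Matrix.isSymm_zero Matrix.PosSemidef.zero
    (lpMatrix A)).comp_linearMap (lpData r n)
  have e1 : lpDom A = lpData r n ⁻¹' dom 0 (lpMatrix A) := by
    ext x
    simp only [lpDom, dom, mem_ofPred_eq, mem_preimage, lpVal_eq_optVal]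
  have e2 : lpOpt A = qpOpt 0 (lpMatrix A) ∘ lpData r n := by
    ext x
    simp only [lpOpt, qpOpt, Function.comp_apply, lpVal_eq_optVal]
  rwa [e1, e2]

end LinearProgram

end QP

theorem mainTheorem1 {m k r n : ℕ}
    (Q : Matrix (Fin m) (Fin m) ℝ) (D : Matrix (Fin k) (Fin m) ℝ) (hQ : Q.IsSymm)
    (A : Matrix (Fin r) (Fin n) ℝ) :
    (QP.CopositiveOn Q (QP.recCone D) → Convex ℝ (QP.dom Q D) →
      -- the concrete family of pieces, for every choice of the generators
      (∀ (L : Finset (Fin k) → ℕ)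
          (gen : (I : Finset (Fin k)) → Fin (L I) → (Fin m → ℝ) × (Fin k → ℝ)),
          QP.IsGeneratorSystem Q D L gen →
          (∀ S ∈ QP.pieceFamily Q D L gen, ∃ p : (Fin m → ℝ) × (Fin k → ℝ) → ℝ,
            QP.IsQuadraticFunction p ∧ ∀ x ∈ S, QP.qpOpt Q D x = p x) →
          QP.IsDCOn (QP.dom Q D) (QP.qpOpt Q D)) ∧
      -- more generally, any finite polyhedral subdivision with quadratic pieces
      (∀ (N : ℕ) (S : Fin N → Set ((Fin m → ℝ) × (Fin k → ℝ))),
          (∀ i, QP.IsPolyhedron (S i)) → QP.dom Q D ⊆ ⋃ i, S i →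
          (∀ i, ∃ p : (Fin m → ℝ) × (Fin k → ℝ) → ℝ,
            QP.IsQuadraticFunction p ∧ ∀ x ∈ S i ∩ QP.dom Q D, QP.qpOpt Q D x = p x) →
          QP.IsDCOn (QP.dom Q D) (QP.qpOpt Q D))) ∧
    (Q.PosSemidef → QP.IsDCOn (QP.dom Q D) (QP.qpOpt Q D)) ∧
    QP.IsDCOn (QP.lpDom A) (QP.lpOpt A) := by
  refine ⟨fun _ hconv => ⟨fun L gen hgen hq => ?_, fun N S hS hcov hq => ?_⟩,
    fun hpos => QP.isDCOn_qpOpt_of_posSemidef hQ hpos D, QP.isDCOn_lpOpt A⟩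
  · refine QP.isDCOn_of_finite_closed_cover hconv (QP.finite_pieceFamily Q D gen)
      (fun S hS => QP.isClosed_of_mem_pieceFamily hS) (QP.dom_subset_sUnion_pieceFamily hQ hgen)
      fun S hS => ?_
    obtain ⟨p, hp, hval⟩ := hq S hS
    exact ⟨p, hp, fun x hx => hval x hx.1⟩
  · refine QP.isDCOn_of_finite_closed_cover hconv (Set.finite_range S) ?_
      (by rwa [Set.sUnion_range]) ?_
    · rintro _ ⟨i, rfl⟩
      exact (hS i).isClosed
    · rintro _ ⟨i, rfl⟩
      exact hq i
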